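/- Standard stochastic blockmodel: let $r\ge 2$, $K\ge 1$, $n=rK$ and $0\le q<p\le 1$. The $n$ nodes are partitioned into $r$ clusters of size $K$ each, and every pair of distinct nodes is joined by an edge, independently of the other pairs, with probability $p$ if both nodes lie in the same cluster and with probability $q$ otherwise. Let $A\in\{0,1\}^{n\times n}$ be the adjacency matrix of the resulting graph, with the convention $a_{ii}=1$ for all $i$. Estimation algorithm (input $A$): let $\hat\lambda_1\ge\hat\lambda_2\ge\dots\ge\hat\lambda_n$ be the eigenvalues of $A$, counted with multiplicity; let $\hat r\in\arg\max_{2\le i\le n-1}(\hat\lambda_i-\hat\lambda_{i+1})$ (ties broken arbitrarily) and put $$\hat K=\frac{n}{\hat r},\qquad \hat p=\frac{\hat K\hat\lambda_1+(n-\hat K)\hat\lambda_2-n}{n(\hat K-1)},\qquad \hat q=\frac{\hat\lambda_1-\hat\lambda_2}{n},\qquad t=\frac{\hat p+\hat q}{2}.$$ Theorem. There are absolute constants $c_0,c_1,c_4>0$ such that, for all $n,r,K,p,q$ as above with $$\frac{p-q}{\sqrt{p(1-q)}}\ \ge\ c_1\max\left\{\frac{\sqrt n}{K},\ \frac{\log^2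 n}{\sqrt K}\right\},$$ the following holds with probability at least $1-c_0n^{-8}$: the algorithm has an output, and every output of it satisfies $$\hat K=K,\qquad \max\{|\hat p-p|,|\hat q-q|\}\le c_4\frac{\sqrt{p(1-q)n}}{K},\qquad \tfrac14p+\tfrac34q\le t\le\tfrac34p+\tfrac14q.$$ -/

import Mathlib

open MeasureTheory ProbabilityTheory

namespace BlockModel

/-- The observed adjacency matrix of a graph on `n` nodes, with the convention `a_ii = 1`. -/
noncomputable def adjacency {n : ℕ} (G : SimpleGraph (Fin n)) : Matrix (Fin n) (Fin n) ℝ :=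
  open Classical in Matrix.of fun i j => if i = j ∨ G.Adj i j then 1 else 0

theorem adjacency_isHermitian {n : ℕ} (G : SimpleGraph (Fin n)) :
    (adjacency G).IsHermitian := by
  ext i j
  have h : (j = i ∨ G.Adj j i) ↔ (i = j ∨ G.Adj i j) := by rw [eq_comm, SimpleGraph.adj_comm]
  by_cases h' : i = j ∨ G.Adj i j
  · simp [adjacency, Matrix.conjTranspose_apply, h', h.2 h']
  · simp [adjacency, Matrix.conjTranspose_apply, h', mt h.1 h']

/-- `IsStandardSBM μ c K p q G`: the random graph `G` on `n` nodes follows the standard stochastic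
blockmodel whose clusters are the fibres of `c : Fin n → Fin r`. All clusters have size `K`, there
are no outliers, and the edges are present independently, with probability `p` inside clusters and
`q` across clusters. -/
structure IsStandardSBM {Ω : Type*} [MeasurableSpace Ω] (μ : Measure Ω) {n r : ℕ}
    (c : Fin n → Fin r) (K : ℕ) (p q : ℝ) (G : Ω → SimpleGraph (Fin n)) : Prop where
  card_cluster : ∀ a : Fin r, (Finset.univ.filter fun i => c i = a).card = K
  measurableSet_adj : ∀ i j : Fin n, MeasurableSet {ω | (G ω).Adj i j}
  indep : iIndepSet (fun e : {e : Fin n × Fin n // e.1 < e.2} => {ω | (G ω).Adj e.1.1 e.1.2}) μ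
  prob_adj : ∀ i j : Fin n, i < j →
    μ {ω | (G ω).Adj i j} = ENNReal.ofReal (if c i = c j then p else q)

/-- `eig G k` is the `k`-th largest eigenvalue (`1 ≤ k ≤ n`, counted with multiplicity) of the
adjacency matrix of `G`. -/
noncomputable def eig {n : ℕ} (G : SimpleGraph (Fin n)) (k : ℕ) : ℝ :=
  if h : k - 1 < Fintype.card (Fin n) then (adjacency_isHermitian G).eigenvalues₀ ⟨k - 1, h⟩ else 0

/-- `r` attains the maximum of `eig G i - eig G (i + 1)` over `2 ≤ i ≤ n - 1`. -/
def IsArgmaxGap {n : ℕ} (G : SimpleGraph (Fin n)) (r : ℕ) : Prop :=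
  r ∈ Finset.Icc 2 (n - 1) ∧
    ∀ i ∈ Finset.Icc 2 (n - 1), eig G i - eig G (i + 1) ≤ eig G r - eig G (r + 1)

/-- `IsOutput G K p q t`: the eigenvalue-based estimation algorithm run on `G` may return
`(K, p, q, t)`; ties in the `argmax` may be broken arbitrarily. -/
def IsOutput {n : ℕ} (G : SimpleGraph (Fin n)) (K p q t : ℝ) : Prop :=
  ∃ r : ℕ, IsArgmaxGap G r ∧
    K = n / r ∧
    p = (K * eig G 1 + (n - K) * eig G 2 - n) / (n * (K - 1)) ∧
    q = (eig G 1 - eig G 2) / n ∧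
    t = (p + q) / 2

end BlockModel

/-!
The adjacency matrix is its expectation plus a noise matrix: a symmetric matrix with zero diagonal
and independent, centred entries of variance at most `σ² = p (1 - q)`. The expectation has the
eigenvalues `K (p - q) + n q + (1 - p)` (once), `K (p - q) + (1 - p)` (`r - 1` times) and `1 - p`,
so by the min-max principle (`le_eigenvalues₀`, `eigenvalues₀_le`, `abs_eig_sub_le`) the eigenvalues
of the adjacency matrix are within `η` of these whenever the quadratic form of the noise is at most
`η |x|²`. If `8 η < K (p - q)`, the `r`-th gap is the only largest one, and the estimators of `p`
and `q`, being linear in the two largest eigenvalues and exact without noise, have error at most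
`2 η / K` (`output_of_noise_le`).

It remains to bound the noise by `η = C √(n σ²)` with probability at least `1 - n⁻⁸`
(`exists_noise_bound`), without a logarithmic loss. The assumption on the signal-to-noise ratio
gives `n σ² ≥ log n` (`signal_to_noise_consequences`), so that Markov's inequality for the trace of
the `2 k`-th power with `k = ⌈n σ²⌉` suffices. Expanded over closed walks, the expected trace only
sees the walks that traverse each of their edges at least twice ("doubled" walks); one with `t`
vertices contributes at most `σ ^ (2 (t - 1))`, as its edges form a connected graph. Grouping walks
by their shape, this is at most `n / k` times the *number* of doubled walks on only `2 k` vertices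
(`sum_isDoubledWalk_pow_le`). That number need not be found by combinatorics: it is at most the
expected trace of the `2 k`-th power of a `2 k × 2 k` matrix with independent bounded entries whose
moments, except the first, which vanishes, are all at least `1`. In this matrix the dimension is of
the order of the exponent, so the trace can be bounded, at the cost of factors exponential in `k`,
by a sum over a net of the sphere and Hoeffding's lemma (`exists_sum_isDoubledWalk_le`).
-/

namespace BlockModel

/-! ### Closed walks and traces of matrix powers -/

section Walks

variable {V W : Type*} {l : ℕ}

/-- The undirected edge traversed in the `i`-th step of the walk `w`; it is a loop (a diagonal
element of `Sym2 V`) when the walk does not move. -/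
def walkStep (w : Fin (l + 1) → V) (i : Fin l) : Sym2 V := s(w i.castSucc, w i.succ)

/-- A closed walk of length `l` without loops all of whose edges are traversed at least twice
(in either direction). Only these contribute to the expected trace of the `l`-th power of a random
symmetric matrix with independent centred entries and zero diagonal. -/
structure IsDoubledWalk (w : Fin (l + 1) → V) : Prop where
  closed : w 0 = w (Fin.last l)
  not_isDiag : ∀ i, ¬ (walkStep w i).IsDiag
  exists_ne : ∀ i, ∃ j, j ≠ i ∧ walkStep w j = walkStep w i

theorem walkStep_comp (f : V → W) (w : Fin (l + 1) → V) (i : Fin l) :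
    walkStep (f ∘ w) i = (walkStep w i).map f := rfl

theorem isDoubledWalk_comp_iff {f : V → W} (hf : Function.Injective f) (w : Fin (l + 1) → V) :
    IsDoubledWalk (f ∘ w) ↔ IsDoubledWalk w := by
  have h : ∀ i, walkStep (f ∘ w) i = (walkStep w i).map f := walkStep_comp f w
  constructor
  · rintro ⟨h1, h2, h3⟩
    refine ⟨hf h1, fun i => ?_, fun i => ?_⟩
    · have := h2 i
      rwa [h, Sym2.isDiag_map hf] at this
    · obtain ⟨j, hj, e⟩ := h3 i
      rw [h, h] at e
      exact ⟨j, hj, Sym2.map.injective hf e⟩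
  · rintro ⟨h1, h2, h3⟩
    refine ⟨congrArg f h1, fun i => ?_, fun i => ?_⟩
    · rw [h, Sym2.isDiag_map hf]
      exact h2 i
    · obtain ⟨j, hj, e⟩ := h3 i
      exact ⟨j, hj, by rw [h, h, e]⟩

variable [DecidableEq V]

/-- The graph traced by a walk is connected, so it has at most one more vertex than edges. -/
theorem card_image_le_card_image_walkStep_add_one (w : Fin (l + 1) → V) :
    (Finset.univ.image w).card ≤ (Finset.univ.image (walkStep w)).card + 1 := by
  induction l with
  | zero =>
    exact (Finset.card_image_le).trans (by simp)
  | succ l ih =>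
    have ih' := ih (fun i => w i.succ)
    have h1 : Finset.univ.image w
        = insert (w 0) (Finset.univ.image fun i : Fin (l + 1) => w i.succ) := by
      rw [Fin.univ_succ, Finset.cons_eq_insert, Finset.image_insert, Finset.map_eq_image,
        Finset.image_image]
      rfl
    have h2 : Finset.univ.image (walkStep w)
        = insert (walkStep w 0) (Finset.univ.image (walkStep fun i : Fin (l + 1) => w i.succ)) := by
      rw [Fin.univ_succ, Finset.cons_eq_insert, Finset.image_insert, Finset.map_eq_image,
        Finset.image_image]
      rfl
    rw [h1, h2]
    by_cases h : w 0 ∈ Finset.univ.image fun i : Fin (l + 1) => w i.succ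
    · rw [Finset.insert_eq_of_mem h]
      exact ih'.trans (Nat.add_le_add_right (Finset.card_le_card (Finset.subset_insert _ _)) 1)
    · have h' : walkStep w 0 ∉ Finset.univ.image (walkStep fun i : Fin (l + 1) => w i.succ) := by
        intro hc
        obtain ⟨i, -, hi⟩ := Finset.mem_image.1 hc
        have hm : w 0 ∈ walkStep (fun i : Fin (l + 1) => w i.succ) i := by
          rw [hi]
          exact Sym2.mem_mk_left _ _
        rcases Sym2.mem_iff.1 hm with e | e
        · exact h (Finset.mem_image.2 ⟨_, Finset.mem_univ _, e.symm⟩)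
        · exact h (Finset.mem_image.2 ⟨_, Finset.mem_univ _, e.symm⟩)
      rw [Finset.card_insert_of_notMem h, Finset.card_insert_of_notMem h']
      omega

theorem IsDoubledWalk.two_mul_card_image_walkStep_le {w : Fin (l + 1) → V}
    (hw : IsDoubledWalk w) : 2 * (Finset.univ.image (walkStep w)).card ≤ l := by
  have h := Finset.mul_card_image_le_card (f := walkStep w) (s := Finset.univ) 2 (fun a ha => by
    obtain ⟨i, -, rfl⟩ := Finset.mem_image.1 ha
    obtain ⟨j, hj, e⟩ := hw.exists_ne i
    exact Finset.one_lt_card.2 ⟨j, by simp [e], i, by simp, hj⟩)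
  simpa using h

theorem IsDoubledWalk.two_mul_card_image_le {w : Fin (l + 1) → V} (hw : IsDoubledWalk w) :
    2 * (Finset.univ.image w).card ≤ l + 2 := by
  have h1 := hw.two_mul_card_image_walkStep_le
  have h2 := card_image_le_card_image_walkStep_add_one w
  omega

end Walks

section Trace

variable {V R : Type*} [Fintype V] [DecidableEq V] [CommRing R]

theorem pow_apply_eq_sum_walks (M : Matrix V V R) (l : ℕ) (a b : V) :
    (M ^ l) a b = ∑ w : Fin (l + 1) → V, if w 0 = a ∧ w (Fin.last l) = b then
      ∏ i : Fin l, M (w i.castSucc) (w i.succ) else 0 := by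
  induction l generalizing a with
  | zero =>
    rw [← (Equiv.funUnique (Fin 1) V).symm.sum_comp]
    by_cases h : a = b
    · subst h
      simp
    · rw [pow_zero, Matrix.one_apply_ne h]
      symm
      refine Finset.sum_eq_zero fun x _ => if_neg ?_
      rintro ⟨h1, h2⟩
      exact h (h1.symm.trans h2)
  | succ l ih =>
    rw [pow_succ', Matrix.mul_apply, ← (Fin.consEquiv fun _ : Fin (l + 2) => V).sum_comp,
      Fintype.sum_prod_type]
    conv_rhs => rw [Finset.sum_eq_single a (fun c _ hc => by simp [Fin.consEquiv, hc]) (by simp)]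
    have hlast : Fin.last (l + 1) = (Fin.last l).succ := rfl
    simp_rw [ih, Finset.mul_sum]
    rw [Finset.sum_comm]
    refine Finset.sum_congr rfl fun w _ => ?_
    rw [Finset.sum_eq_single (w 0) (fun c _ hc => by simp [hc.symm]) (by simp)]
    simp [Fin.consEquiv, hlast, Fin.prod_univ_succ, -Fin.succ_last, -Fin.castSucc_succ,
      ← Fin.succ_castSucc]

theorem trace_pow_eq_sum_walks (M : Matrix V V R) (l : ℕ) :
    (M ^ l).trace = ∑ w : Fin (l + 1) → V, if w 0 = w (Fin.last l) then
      ∏ i : Fin l, M (w i.castSucc) (w i.succ) else 0 := by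
  simp_rw [Matrix.trace, Matrix.diag_apply, pow_apply_eq_sum_walks]
  rw [Finset.sum_comm]
  refine Finset.sum_congr rfl fun w _ => ?_
  rw [Finset.sum_eq_single (w 0)]
  · simp [eq_comm]
  · intro c _ hc
    simp [hc.symm]
  · simp

end Trace

section Count

noncomputable instance {α : Type*} [Finite α] : Fintype (Setoid α) :=
  @Fintype.ofFinite _ (Finite.of_injective (fun s : Setoid α => s.r) fun _ _ h =>
    Setoid.ext fun a b => iff_of_eq (congrFun (congrFun h a) b))

open Classical in
/-- A walk on `n` labelled vertices is the choice of its shape (which times visit the same vertex)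
together with an injective labelling of the classes of the shape. Hence a sum over doubled walks
splits into a sum over shapes, which does not involve `n`, and a falling factorial. -/
theorem sum_isDoubledWalk_eq_sum_setoid (n l : ℕ) (g : ℕ → ℝ) :
    ∑ w : Fin (l + 1) → Fin n, (if IsDoubledWalk w then g (Finset.univ.image w).card else 0)
      = ∑ s : Setoid (Fin (l + 1)),
        if IsDoubledWalk (fun i => Quotient.mk s i) then
          (n.descFactorial (Fintype.card (Quotient s)) : ℝ) * g (Fintype.card (Quotient s))
        else 0 := by
  rw [← Finset.sum_fiberwise Finset.univ (fun w : Fin (l + 1) → Fin n => Setoid.ker w)]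
  refine Finset.sum_congr rfl fun s _ => ?_
  let e : (Quotient s ↪ Fin n) ≃ {w : Fin (l + 1) → Fin n // Setoid.ker w = s} :=
    { toFun := fun f => ⟨fun i => f (Quotient.mk s i), by
        ext i j
        exact f.injective.eq_iff.trans Quotient.eq⟩
      invFun := fun w => ⟨Quotient.lift w.1 (fun i j h => by
          rw [← w.2] at h
          exact h), by
        rintro ⟨i⟩ ⟨j⟩ h
        refine Quotient.sound ?_
        rw [← w.2]
        exact h⟩
      left_inv := fun f => by
        ext x
        induction x using Quotient.inductionOn
        rfl
      right_inv := fun w => rfl }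
  have key : ∀ f : Quotient s ↪ Fin n,
      (if IsDoubledWalk (e f).1 then g (Finset.univ.image (e f).1).card else 0)
        = if IsDoubledWalk (fun i => Quotient.mk s i) then
            g (Fintype.card (Quotient s)) else 0 := by
    intro f
    have h1 : IsDoubledWalk (e f).1 ↔ IsDoubledWalk (fun i => Quotient.mk s i) :=
      isDoubledWalk_comp_iff f.injective _
    have h2 : (Finset.univ.image (e f).1).card = Fintype.card (Quotient s) := by
      have : Finset.univ.image (e f).1 = Finset.univ.image f := by
        ext x
        simp only [Finset.mem_image, Finset.mem_univ, true_and]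
        constructor
        · rintro ⟨i, rfl⟩
          exact ⟨_, rfl⟩
        · rintro ⟨y, rfl⟩
          obtain ⟨i, rfl⟩ := Quotient.exists_rep y
          exact ⟨i, rfl⟩
      rw [this, Finset.card_image_of_injective _ f.injective, Finset.card_univ]
    simp only [h1, h2]
  rw [← Finset.sum_subtype_eq_sum_filter, Finset.subtype_univ]
  rw [← e.sum_comp, Finset.sum_congr rfl fun f _ => key f, Finset.sum_const, Finset.card_univ,
    Fintype.card_embedding_eq, Fintype.card_fin]
  split_ifs <;> simp

open Classical in
/-- Comparison of dimensions: weighting the doubled walks of length `2 k` on `n` vertices by the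
variance `σ2` per edge of a spanning tree gives at most `n / k` times the number of such walks on
`2 k` vertices, as soon as `n * σ2 ≤ k`. -/
theorem sum_isDoubledWalk_pow_le (n k : ℕ) (σ2 : ℝ) (hσ : 0 ≤ σ2) (hk : 0 < k)
    (hnk : n * σ2 ≤ k) :
    ∑ w : Fin (2 * k + 1) → Fin n,
        (if IsDoubledWalk w then σ2 ^ ((Finset.univ.image w).card - 1) else 0)
      ≤ (n / k : ℝ) * ∑ w : Fin (2 * k + 1) → Fin (2 * k), if IsDoubledWalk w then 1 else 0 := by
  rw [sum_isDoubledWalk_eq_sum_setoid n (2 * k) (fun t => σ2 ^ (t - 1)),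
    sum_isDoubledWalk_eq_sum_setoid (2 * k) (2 * k) (fun _ => 1), Finset.mul_sum]
  refine Finset.sum_le_sum fun s _ => ?_
  split_ifs with h
  · have ht := h.two_mul_card_image_le
    have h2 : Finset.univ.image (fun i => Quotient.mk s i) = Finset.univ :=
      Finset.image_univ_of_surjective Quotient.mk_surjective
    rw [h2, Finset.card_univ] at ht
    have hpos : 0 < Fintype.card (Quotient s) := Fintype.card_pos_iff.2 ⟨Quotient.mk s 0⟩
    set t := Fintype.card (Quotient s)
    obtain ⟨u, hu⟩ : ∃ u, t = u + 1 := ⟨t - 1, by omega⟩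
    have h3 : ((2 * k).descFactorial t : ℝ) ≥ (k : ℝ) ^ t := by
      have := Nat.pow_sub_le_descFactorial (2 * k) t
      have h4 : k ^ t ≤ (2 * k + 1 - t) ^ t := Nat.pow_le_pow_left (by omega) t
      exact_mod_cast h4.trans this
    have h5 : (n.descFactorial t : ℝ) ≤ (n : ℝ) ^ t := by
      exact_mod_cast Nat.descFactorial_le_pow n t
    have hk' : (0 : ℝ) < k := by exact_mod_cast hk
    calc (n.descFactorial t : ℝ) * σ2 ^ (t - 1) ≤ (n : ℝ) ^ t * σ2 ^ (t - 1) := by gcongr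
      _ = n * (n * σ2) ^ u := by rw [hu, Nat.add_sub_cancel, mul_pow]; ring
      _ ≤ n * (k : ℝ) ^ u := by gcongr
      _ = (n / k : ℝ) * (k : ℝ) ^ t := by rw [hu, pow_succ]; field_simp
      _ ≤ (n / k : ℝ) * (((2 * k).descFactorial t : ℝ) * 1) := by
        rw [mul_one]
        gcongr
  · simp

end Count

/-! ### Symmetric matrices with independent entries -/

section EdgeMatrix

variable {n l : ℕ}

/-- The pairs `i < j` of nodes, which index the independent entries of a symmetric matrix. -/
abbrev Edge (n : ℕ) := {e : Fin n × Fin n // e.1 < e.2}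

/-- The unordered pair underlying an edge. -/
def Edge.toSym2 (e : Edge n) : Sym2 (Fin n) := s(e.1.1, e.1.2)

theorem Edge.toSym2_injective : Function.Injective (Edge.toSym2 (n := n)) := by
  rintro ⟨⟨a, b⟩, h⟩ ⟨⟨c, d⟩, h'⟩ e
  simp only [Edge.toSym2, Sym2.eq_iff] at e
  simp only at h h'
  rcases e with ⟨rfl, rfl⟩ | ⟨rfl, rfl⟩
  · rfl
  · exact absurd h (lt_asymm h')

theorem Edge.exists_toSym2_eq {x : Sym2 (Fin n)} (hx : ¬ x.IsDiag) :
    ∃ e : Edge n, e.toSym2 = x := by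
  induction x using Sym2.inductionOn with
  | _ a b =>
    rcases lt_trichotomy a b with h | h | h
    · exact ⟨⟨(a, b), h⟩, rfl⟩
    · exact absurd (Sym2.mk_isDiag_iff.2 h) hx
    · exact ⟨⟨(b, a), h⟩, Sym2.eq_swap⟩

/-- The symmetric matrix with zero diagonal and prescribed entries above the diagonal. -/
def edgeMatrix (z : Edge n → ℝ) : Matrix (Fin n) (Fin n) ℝ :=
  Matrix.of fun i j => if h : i < j then z ⟨(i, j), h⟩ else if h : j < i then z ⟨(j, i), h⟩ else 0

theorem edgeMatrix_isHermitian (z : Edge n → ℝ) : (edgeMatrix z).IsHermitian := by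
  ext i j
  rcases lt_trichotomy i j with h | h | h
  · simp [edgeMatrix, h, h.not_gt]
  · simp [edgeMatrix, h]
  · simp [edgeMatrix, h, h.not_gt]

theorem edgeMatrix_self (z : Edge n → ℝ) (i : Fin n) : edgeMatrix z i i = 0 := by
  simp [edgeMatrix]

theorem edgeMatrix_apply_of_toSym2_eq (z : Edge n → ℝ) {i j : Fin n} {e : Edge n}
    (h : e.toSym2 = s(i, j)) : edgeMatrix z i j = z e := by
  obtain ⟨⟨a, b⟩, hab⟩ := e
  simp only [Edge.toSym2, Sym2.eq_iff] at h
  simp only at hab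
  rcases h with ⟨rfl, rfl⟩ | ⟨rfl, rfl⟩
  · simp [edgeMatrix, hab]
  · simp [edgeMatrix, hab, hab.not_gt]

/-- How often the walk `w` traverses the edge `e`. -/
def traversals (w : Fin (l + 1) → Fin n) (e : Edge n) : ℕ :=
  (Finset.univ.filter fun i => walkStep w i = e.toSym2).card

theorem prod_edgeMatrix_eq_prod_pow (z : Edge n → ℝ) {w : Fin (l + 1) → Fin n}
    (hw : ∀ i, ¬ (walkStep w i).IsDiag) :
    ∏ i : Fin l, edgeMatrix z (w i.castSucc) (w i.succ) = ∏ e : Edge n, z e ^ traversals w e := by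
  have h : ∀ i : Fin l, edgeMatrix z (w i.castSucc) (w i.succ)
      = ∏ e : Edge n, if walkStep w i = e.toSym2 then z e else 1 := by
    intro i
    obtain ⟨e, he⟩ := Edge.exists_toSym2_eq (hw i)
    rw [Finset.prod_eq_single e, if_pos he.symm, edgeMatrix_apply_of_toSym2_eq z he]
    · intro e' _ hne
      exact if_neg fun h => hne (Edge.toSym2_injective (h.symm.trans he.symm))
    · simp
  rw [Finset.prod_congr rfl fun i _ => h i, Finset.prod_comm]
  refine Finset.prod_congr rfl fun e _ => ?_
  rw [Finset.prod_ite, Finset.prod_const, Finset.prod_const_one, mul_one, traversals]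

theorem prod_edgeMatrix_eq_zero (z : Edge n → ℝ) {w : Fin (l + 1) → Fin n} {i : Fin l}
    (hw : (walkStep w i).IsDiag) : ∏ i : Fin l, edgeMatrix z (w i.castSucc) (w i.succ) = 0 := by
  refine Finset.prod_eq_zero (Finset.mem_univ i) ?_
  rw [Sym2.mk_isDiag_iff.1 hw, edgeMatrix_self]

theorem IsDoubledWalk.traversals_ne_one {w : Fin (l + 1) → Fin n} (hw : IsDoubledWalk w)
    (e : Edge n) : traversals w e ≠ 1 := by
  intro h
  obtain ⟨i, hi⟩ := Finset.card_eq_one.1 h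
  have hi' : i ∈ Finset.univ.filter fun i => walkStep w i = e.toSym2 := by simp [hi]
  obtain ⟨j, hj, hji⟩ := hw.exists_ne i
  have hj' : j ∈ Finset.univ.filter fun i => walkStep w i = e.toSym2 := by
    simp only [Finset.mem_filter, Finset.mem_univ, true_and] at hi' ⊢
    rw [hji, hi']
  rw [hi, Finset.mem_singleton] at hj'
  exact hj hj'

theorem exists_traversals_eq_one {w : Fin (l + 1) → Fin n} (hc : w 0 = w (Fin.last l))
    (hd : ∀ i, ¬ (walkStep w i).IsDiag) (hw : ¬ IsDoubledWalk w) :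
    ∃ e : Edge n, traversals w e = 1 := by
  have : ¬ ∀ i, ∃ j, j ≠ i ∧ walkStep w j = walkStep w i := fun h => hw ⟨hc, hd, h⟩
  push Not at this
  obtain ⟨i, hi⟩ := this
  obtain ⟨e, he⟩ := Edge.exists_toSym2_eq (hd i)
  refine ⟨e, Finset.card_eq_one.2 ⟨i, ?_⟩⟩
  ext j
  simp only [Finset.mem_filter, Finset.mem_univ, true_and, Finset.mem_singleton, he]
  constructor
  · intro h
    by_contra hne
    exact hi j hne h
  · rintro rfl
    rfl

theorem card_image_sub_one_le_card_traversals (w : Fin (l + 1) → Fin n)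
    (hd : ∀ i, ¬ (walkStep w i).IsDiag) :
    (Finset.univ.image w).card - 1 ≤ (Finset.univ.filter fun e => traversals w e ≠ 0).card := by
  have h1 := card_image_le_card_image_walkStep_add_one w
  have h2 : Finset.univ.image (walkStep w)
      ⊆ (Finset.univ.filter fun e => traversals w e ≠ 0).image Edge.toSym2 := by
    intro x hx
    obtain ⟨i, -, rfl⟩ := Finset.mem_image.1 hx
    obtain ⟨e, he⟩ := Edge.exists_toSym2_eq (hd i)
    refine Finset.mem_image.2 ⟨e, ?_, he⟩
    simp only [Finset.mem_filter, Finset.mem_univ, true_and]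
    exact Finset.card_ne_zero.2 ⟨i, by simp [he]⟩
  have h3 := (Finset.card_le_card h2).trans Finset.card_image_le
  omega

end EdgeMatrix

section Moments

variable {Ω : Type*} [MeasurableSpace Ω] {μ : Measure Ω} {n : ℕ} {Z : Edge n → Ω → ℝ} {B : ℝ}

open Classical in
theorem integral_trace_edgeMatrix_pow (hZ : iIndepFun Z μ) (hm : ∀ e, Measurable (Z e))
    (hB : ∀ e ω, |Z e ω| ≤ B) (l : ℕ) :
    Integrable (fun ω => (edgeMatrix (fun e => Z e ω) ^ l).trace) μ ∧
    ∫ ω, (edgeMatrix (fun e => Z e ω) ^ l).trace ∂μ = ∑ w : Fin (l + 1) → Fin n,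
      if w 0 = w (Fin.last l) ∧ ∀ i, ¬ (walkStep w i).IsDiag then
        ∏ e, ∫ ω, Z e ω ^ traversals w e ∂μ else 0 := by
  have := hZ.isProbabilityMeasure
  have h1 : ∀ ω, (edgeMatrix (fun e => Z e ω) ^ l).trace = ∑ w : Fin (l + 1) → Fin n,
      if w 0 = w (Fin.last l) ∧ ∀ i, ¬ (walkStep w i).IsDiag then
        ∏ e, Z e ω ^ traversals w e else 0 := by
    intro ω
    rw [trace_pow_eq_sum_walks]
    refine Finset.sum_congr rfl fun w _ => ?_
    by_cases hd : ∀ i, ¬ (walkStep w i).IsDiag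
    · simp only [hd, not_false_eq_true, implies_true, and_true, prod_edgeMatrix_eq_prod_pow _ hd]
    · rw [if_neg (c := _ ∧ _) fun h => hd h.2]
      push Not at hd
      obtain ⟨i, hi⟩ := hd
      rw [prod_edgeMatrix_eq_zero _ hi, ite_self]
  have h2 : ∀ w : Fin (l + 1) → Fin n, Integrable (fun ω => ∏ e, Z e ω ^ traversals w e) μ := by
    intro w
    refine Integrable.of_bound (C := ∏ e, B ^ traversals w e)
      (Finset.measurable_prod _ fun e _ => (hm e).pow_const _).aestronglyMeasurable
      (ae_of_all _ fun ω => ?_)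
    rw [Real.norm_eq_abs, Finset.abs_prod]
    refine Finset.prod_le_prod (fun e _ => abs_nonneg _) fun e _ => ?_
    rw [abs_pow]
    exact pow_le_pow_left₀ (abs_nonneg _) (hB e ω) _
  have h3 : ∀ w : Fin (l + 1) → Fin n, Integrable (fun ω =>
      if w 0 = w (Fin.last l) ∧ ∀ i, ¬ (walkStep w i).IsDiag then
        ∏ e, Z e ω ^ traversals w e else 0) μ := by
    intro w
    split_ifs
    · exact h2 w
    · exact integrable_zero _ _ _
  simp_rw [h1]
  refine ⟨integrable_finsetSum _ fun w _ => h3 w, ?_⟩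
  rw [integral_finsetSum _ fun w _ => h3 w]
  refine Finset.sum_congr rfl fun w _ => ?_
  split_ifs
  · exact hZ.integral_fun_prod_comp (f := fun e x => x ^ traversals w e)
      (fun e => (hm e).aemeasurable)
      (fun e => (measurable_id.pow_const _).aestronglyMeasurable)
  · simp

open Classical in
/-- A walk that traverses some edge exactly once contributes `0`; in a doubled walk each edge
contributes at most the variance, and there are at least as many edges as vertices minus one. -/
theorem integral_trace_edgeMatrix_pow_le (hZ : iIndepFun Z μ) (hm : ∀ e, Measurable (Z e))
    (hB : ∀ e ω, |Z e ω| ≤ B) {σ2 : ℝ} (hσ0 : 0 ≤ σ2) (hσ1 : σ2 ≤ 1)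
    (h0 : ∀ e, ∫ ω, Z e ω ∂μ = 0) (h2 : ∀ e, ∀ j, 2 ≤ j → |∫ ω, Z e ω ^ j ∂μ| ≤ σ2) (l : ℕ) :
    ∫ ω, (edgeMatrix (fun e => Z e ω) ^ l).trace ∂μ ≤ ∑ w : Fin (l + 1) → Fin n,
      if IsDoubledWalk w then σ2 ^ ((Finset.univ.image w).card - 1) else 0 := by
  have := hZ.isProbabilityMeasure
  rw [(integral_trace_edgeMatrix_pow hZ hm hB l).2]
  refine Finset.sum_le_sum fun w _ => ?_
  by_cases hd : IsDoubledWalk w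
  · rw [if_pos ⟨hd.closed, hd.not_isDiag⟩, if_pos hd]
    calc ∏ e, ∫ ω, Z e ω ^ traversals w e ∂μ ≤ ∏ e, |∫ ω, Z e ω ^ traversals w e ∂μ| := by
          rw [← Finset.abs_prod]
          exact le_abs_self _
      _ ≤ ∏ e, if traversals w e ≠ 0 then σ2 else 1 := by
          refine Finset.prod_le_prod (fun e _ => abs_nonneg _) fun e _ => ?_
          split_ifs with h
          · exact h2 e _ (by have := hd.traversals_ne_one e; omega)
          · push Not at h
            simp [h]
      _ = σ2 ^ (Finset.univ.filter fun e => traversals w e ≠ 0).card := by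
          rw [Finset.prod_ite, Finset.prod_const, Finset.prod_const_one, mul_one]
      _ ≤ σ2 ^ ((Finset.univ.image w).card - 1) :=
          pow_le_pow_of_le_one hσ0 hσ1 (card_image_sub_one_le_card_traversals w hd.not_isDiag)
  · rw [if_neg hd]
    split_ifs with h
    · obtain ⟨e, he⟩ := exists_traversals_eq_one h.1 h.2 hd
      exact (Finset.prod_eq_zero (Finset.mem_univ e) (by simp [he, h0])).le
    · exact le_rfl

open Classical in
/-- When all moments of the entries but the first are at least `1`, every doubled walk contributes
at least `1` to the expected trace, and no walk contributes negatively. -/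
theorem sum_isDoubledWalk_le_integral_trace (hZ : iIndepFun Z μ) (hm : ∀ e, Measurable (Z e))
    (hB : ∀ e ω, |Z e ω| ≤ B) (h0 : ∀ e, ∀ j, 0 ≤ ∫ ω, Z e ω ^ j ∂μ)
    (h1 : ∀ e, ∀ j, j ≠ 1 → 1 ≤ ∫ ω, Z e ω ^ j ∂μ) (l : ℕ) :
    ∑ w : Fin (l + 1) → Fin n, (if IsDoubledWalk w then (1 : ℝ) else 0)
      ≤ ∫ ω, (edgeMatrix (fun e => Z e ω) ^ l).trace ∂μ := by
  rw [(integral_trace_edgeMatrix_pow hZ hm hB l).2]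
  refine Finset.sum_le_sum fun w _ => ?_
  by_cases hd : IsDoubledWalk w
  · rw [if_pos hd, if_pos ⟨hd.closed, hd.not_isDiag⟩]
    calc (1 : ℝ) = ∏ _e : Edge n, (1 : ℝ) := by simp
      _ ≤ _ := Finset.prod_le_prod (fun _ _ => zero_le_one)
        fun e _ => h1 e _ (hd.traversals_ne_one e)
  · rw [if_neg hd]
    split_ifs with h
    · exact Finset.prod_nonneg fun e _ => h0 e _
    · exact le_rfl

end Moments

/-! ### Spectral bounds and a net of the sphere -/

section Spectral

open Matrix

variable {V : Type*} [Fintype V] [DecidableEq V] {M : Matrix V V ℝ}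

/-- The `i`-th vector of an orthonormal eigenbasis of `M`, as a plain function. -/
noncomputable def eigenvec (hM : M.IsHermitian) (i : V) : V → ℝ := (hM.eigenvectorBasis i).ofLp

theorem mulVec_eigenvec (hM : M.IsHermitian) (i : V) :
    M *ᵥ eigenvec hM i = hM.eigenvalues i • eigenvec hM i :=
  hM.mulVec_eigenvectorBasis i

theorem eigenvec_dotProduct_mulVec (hM : M.IsHermitian) (i : V) (x : V → ℝ) :
    eigenvec hM i ⬝ᵥ M *ᵥ x = hM.eigenvalues i * (eigenvec hM i ⬝ᵥ x) := by
  have h : Mᵀ = M := by simpa [conjTranspose_eq_transpose_of_trivial] using hM.eq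
  rw [dotProduct_mulVec, ← mulVec_transpose, h, mulVec_eigenvec, smul_dotProduct, smul_eq_mul]

theorem dotProduct_eq_sum_eigenvec (hM : M.IsHermitian) (x y : V → ℝ) :
    x ⬝ᵥ y = ∑ i, (eigenvec hM i ⬝ᵥ x) * (eigenvec hM i ⬝ᵥ y) := by
  have h := hM.eigenvectorBasis.sum_inner_mul_inner (WithLp.toLp 2 x) (WithLp.toLp 2 y)
  simp only [EuclideanSpace.inner_eq_star_dotProduct, star_trivial] at h
  rw [dotProduct_comm, ← h]
  refine Finset.sum_congr rfl fun i _ => ?_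
  rw [dotProduct_comm y]
  rfl

theorem dotProduct_mulVec_eq_sum_eigenvec (hM : M.IsHermitian) (x y : V → ℝ) :
    x ⬝ᵥ M *ᵥ y
      = ∑ i, hM.eigenvalues i * ((eigenvec hM i ⬝ᵥ x) * (eigenvec hM i ⬝ᵥ y)) := by
  rw [dotProduct_eq_sum_eigenvec hM]
  refine Finset.sum_congr rfl fun i _ => ?_
  rw [eigenvec_dotProduct_mulVec]
  ring

theorem eigenvec_dotProduct_self (hM : M.IsHermitian) (i : V) :
    eigenvec hM i ⬝ᵥ eigenvec hM i = 1 := by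
  have h := hM.eigenvectorBasis.inner_eq_one i
  rwa [EuclideanSpace.inner_eq_star_dotProduct, star_trivial] at h

theorem eigenvec_dotProduct_of_ne (hM : M.IsHermitian) {i j : V} (hij : i ≠ j) :
    eigenvec hM i ⬝ᵥ eigenvec hM j = 0 := by
  have h := hM.eigenvectorBasis.inner_eq_zero hij.symm
  rwa [EuclideanSpace.inner_eq_star_dotProduct, star_trivial] at h

theorem dotProduct_mulVec_sq_le (hM : M.IsHermitian) {ρ : ℝ}
    (hρ : ∀ i, |hM.eigenvalues i| ≤ ρ)
    (x y : V → ℝ) : (x ⬝ᵥ M *ᵥ y) ^ 2 ≤ ρ ^ 2 * ((x ⬝ᵥ x) * (y ⬝ᵥ y)) := by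
  rw [dotProduct_mulVec_eq_sum_eigenvec hM, dotProduct_eq_sum_eigenvec hM x x,
    dotProduct_eq_sum_eigenvec hM y y]
  have h1 : |∑ i, hM.eigenvalues i * ((eigenvec hM i ⬝ᵥ x) * (eigenvec hM i ⬝ᵥ y))|
      ≤ ρ * ∑ i, |eigenvec hM i ⬝ᵥ x| * |eigenvec hM i ⬝ᵥ y| := by
    rw [Finset.mul_sum]
    refine (Finset.abs_sum_le_sum_abs _ _).trans (Finset.sum_le_sum fun i _ => ?_)
    rw [abs_mul, abs_mul]
    exact mul_le_mul_of_nonneg_right (hρ i) (by positivity)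
  have h2 := Finset.sum_mul_sq_le_sq_mul_sq Finset.univ
    (fun i => |eigenvec hM i ⬝ᵥ x|) (fun i => |eigenvec hM i ⬝ᵥ y|)
  simp only [sq_abs] at h2
  rw [← sq_abs]
  refine (pow_le_pow_left₀ (abs_nonneg _) h1 2).trans ?_
  rw [mul_pow]
  refine mul_le_mul_of_nonneg_left (h2.trans (le_of_eq ?_)) (by positivity)
  simp only [sq]

theorem trace_pow_eq_sum_eigenvalues_pow (hM : M.IsHermitian) (k : ℕ) :
    (M ^ k).trace = ∑ i, hM.eigenvalues i ^ k := by
  conv_lhs => rw [hM.spectral_theorem, ← map_pow, Unitary.conjStarAlgAut_apply, diagonal_pow,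
    trace_mul_cycle]
  simp [Matrix.trace]

/-- A bound on the trace of an even power controls the quadratic form. -/
theorem abs_dotProduct_mulVec_le_of_trace_pow_lt (hM : M.IsHermitian) {η : ℝ} (hη : 0 ≤ η) {k : ℕ}
    (h : (M ^ (2 * k)).trace < η ^ (2 * k)) (x : V → ℝ) : |x ⬝ᵥ M *ᵥ x| ≤ η * (x ⬝ᵥ x) := by
  have hev : ∀ i, |hM.eigenvalues i| ≤ η := by
    intro i
    have h1 : hM.eigenvalues i ^ (2 * k) ≤ ∑ j, hM.eigenvalues j ^ (2 * k) :=
      Finset.single_le_sum (f := fun j => hM.eigenvalues j ^ (2 * k))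
        (fun j _ => (even_two_mul k).pow_nonneg _) (Finset.mem_univ i)
    rw [← trace_pow_eq_sum_eigenvalues_pow, ← (even_two_mul k).pow_abs] at h1
    exact (lt_of_pow_lt_pow_left₀ _ hη (h1.trans_lt h)).le
  have h2 := dotProduct_mulVec_sq_le hM hev x x
  have h3 : 0 ≤ x ⬝ᵥ x := Finset.sum_nonneg fun i _ => mul_self_nonneg _
  refine abs_le_of_sq_le_sq (h2.trans (le_of_eq (by ring))) (by positivity)

end Spectral

section Net

open Matrix

theorem exists_sum_two_pow_natAbs_le :
    ∃ C : ℝ, 0 ≤ C ∧ ∀ s : Finset ℤ, ∑ g ∈ s, (1 / 2 : ℝ) ^ g.natAbs ≤ C := by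
  have h : Summable fun g : ℤ => (1 / 2 : ℝ) ^ g.natAbs := by
    refine Summable.of_nat_of_neg ?_ ?_
    · simpa using summable_geometric_two
    · simpa using summable_geometric_two
  exact ⟨_, tsum_nonneg fun g => by positivity,
    fun s => h.sum_le_tsum s fun g _ => by positivity⟩

/-- Vectors of norm at most `√(9 m)` with integer coordinates: their number is exponential in `m`,
because it is at most the sum of `2 ^ (9 m - ∑ |g i|)`, which factors over the coordinates. -/
theorem exists_card_integer_ball_le : ∃ C : ℝ, 0 ≤ C ∧ ∀ m : ℕ,
    ∃ S : Finset (Fin m → ℤ), (∀ g, g ∈ S ↔ ∑ i, g i ^ 2 ≤ 9 * m) ∧ (S.card : ℝ) ≤ C ^ m := by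
  obtain ⟨C, hC0, hC⟩ := exists_sum_two_pow_natAbs_le
  refine ⟨2 ^ 9 * C, by positivity, fun m => ?_⟩
  refine ⟨(Fintype.piFinset fun _ => Finset.Icc (-(9 * m : ℤ)) (9 * m)).filter
    fun g => ∑ i, g i ^ 2 ≤ 9 * m, fun g => ?_, ?_⟩
  · simp only [Finset.mem_filter, Fintype.mem_piFinset, Finset.mem_Icc, and_iff_right_iff_imp]
    intro h i
    have h1 : g i ^ 2 ≤ 9 * m :=
      (Finset.single_le_sum (f := fun i => g i ^ 2) (fun j _ => sq_nonneg _)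
        (Finset.mem_univ i)).trans h
    have h2 : |g i| ≤ g i ^ 2 := by
      rw [← Int.natCast_natAbs]
      exact Int.natAbs_le_self_sq _
    exact abs_le.1 (h2.trans h1)
  · rw [Finset.card_eq_sum_ones, Nat.cast_sum]
    calc ∑ g ∈ (Fintype.piFinset fun _ => Finset.Icc (-(9 * m : ℤ)) (9 * m)).filter
          (fun g : Fin m → ℤ => ∑ i, g i ^ 2 ≤ 9 * m), ((1 : ℕ) : ℝ)
        ≤ ∑ g ∈ (Fintype.piFinset fun _ => Finset.Icc (-(9 * m : ℤ)) (9 * m)).filter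
          (fun g : Fin m → ℤ => ∑ i, g i ^ 2 ≤ 9 * m),
          ∏ i, 2 ^ 9 * (1 / 2 : ℝ) ^ (g i).natAbs := by
          refine Finset.sum_le_sum fun g hg => ?_
          have h1 := (Finset.mem_filter.1 hg).2
          have h2 : ∑ i, (g i).natAbs ≤ 9 * m := by
            zify
            refine (Finset.sum_le_sum fun i _ => ?_).trans h1
            rw [← Int.natCast_natAbs]
            exact Int.natAbs_le_self_sq _
          rw [Finset.prod_mul_distrib, Finset.prod_const, Finset.card_univ, Fintype.card_fin,
            Finset.prod_pow_eq_pow_sum, ← pow_mul]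
          calc ((1 : ℕ) : ℝ) = 2 ^ (9 * m) * (1 / 2 : ℝ) ^ (9 * m) := by
                rw [← mul_pow]; norm_num
            _ ≤ _ := mul_le_mul_of_nonneg_left
                (pow_le_pow_of_le_one (by norm_num) (by norm_num) h2) (by positivity)
      _ ≤ ∑ g ∈ Fintype.piFinset fun _ => Finset.Icc (-(9 * m : ℤ)) (9 * m),
          ∏ i : Fin m, 2 ^ 9 * (1 / 2 : ℝ) ^ (g i).natAbs :=
          Finset.sum_le_sum_of_subset_of_nonneg (Finset.filter_subset _ _)
            fun g _ _ => Finset.prod_nonneg fun i _ => by positivity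
      _ = ∏ _i : Fin m, ∑ g ∈ Finset.Icc (-(9 * m : ℤ)) (9 * m),
          2 ^ 9 * (1 / 2 : ℝ) ^ g.natAbs := by rw [Finset.prod_univ_sum]
      _ ≤ (2 ^ 9 * C) ^ m := by
          rw [Finset.prod_const, Finset.card_univ, Fintype.card_fin, ← Finset.mul_sum]
          refine pow_le_pow_left₀ (by positivity) ?_ _
          exact mul_le_mul_of_nonneg_left (hC _) (by norm_num)

/-- A `1/4`-net of the unit sphere of exponential size: round to the lattice of mesh
`1 / (2 √m)`. -/
theorem exists_net : ∃ C : ℝ, 1 ≤ C ∧ ∀ m : ℕ, ∃ N : Finset (Fin m → ℝ),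
    (N.card : ℝ) ≤ C ^ m ∧ (∀ z ∈ N, z ⬝ᵥ z ≤ 9 / 4) ∧
    ∀ v : Fin m → ℝ, v ⬝ᵥ v = 1 → ∃ z ∈ N, (v - z) ⬝ᵥ (v - z) ≤ 1 / 16 := by
  classical
  obtain ⟨C, hC0, hC⟩ := exists_card_integer_ball_le
  refine ⟨max C 1, le_max_right _ _, fun m => ?_⟩
  obtain ⟨S, hS, hcard⟩ := hC m
  rcases Nat.eq_zero_or_pos m with rfl | hm
  · exact ⟨∅, by simp, by simp, fun v hv => by simp [dotProduct] at hv⟩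
  have hm' : (0 : ℝ) < m := by exact_mod_cast hm
  have hs : √(m : ℝ) ^ 2 = m := Real.sq_sqrt hm'.le
  have hs0 : 0 < √(m : ℝ) := Real.sqrt_pos.2 hm'
  have hz : ∀ g : Fin m → ℤ, ∑ i, ((g i : ℝ) / (2 * √m)) * ((g i : ℝ) / (2 * √m))
      = (∑ i, (g i : ℝ) ^ 2) / (4 * m) := by
    intro g
    rw [Finset.sum_div]
    refine Finset.sum_congr rfl fun i _ => ?_
    rw [div_mul_div_comm, mul_mul_mul_comm, ← sq √(m : ℝ), hs]
    ring
  refine ⟨S.image fun g i => (g i : ℝ) / (2 * √m), ?_, ?_, ?_⟩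
  · calc ((S.image _).card : ℝ) ≤ S.card := by exact_mod_cast Finset.card_image_le
      _ ≤ C ^ m := hcard
      _ ≤ max C 1 ^ m := pow_le_pow_left₀ hC0 (le_max_left _ _) _
  · intro z hz'
    obtain ⟨g, hg, rfl⟩ := Finset.mem_image.1 hz'
    have h1 : (∑ i, (g i : ℝ) ^ 2) ≤ 9 * m := by exact_mod_cast (hS g).1 hg
    simp only [dotProduct]
    rw [hz, div_le_iff₀ (by positivity)]
    linarith
  · intro v hv
    let g : Fin m → ℤ := fun i => round (2 * √m * v i)
    have h1 : ∀ i, (v i - (g i : ℝ) / (2 * √m)) * (v i - (g i : ℝ) / (2 * √m)) ≤ 1 / (16 * m) := by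
      intro i
      have h2 := abs_sub_round (2 * √m * v i)
      have h3 : v i - (g i : ℝ) / (2 * √m) = (2 * √m * v i - g i) / (2 * √m) := by field_simp
      rw [h3, div_mul_div_comm, ← abs_mul_abs_self (2 * √m * v i - g i),
        div_le_div_iff₀ (by positivity) (by positivity)]
      have h4 : |2 * √m * v i - g i| * |2 * √m * v i - g i| ≤ 1 / 2 * (1 / 2) :=
        mul_le_mul h2 h2 (abs_nonneg _) (by norm_num)
      nlinarith
    have h5 : ∑ i, (v i - (g i : ℝ) / (2 * √m)) * (v i - (g i : ℝ) / (2 * √m)) ≤ 1 / 16 := by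
      refine (Finset.sum_le_sum fun i _ => h1 i).trans (le_of_eq ?_)
      rw [Finset.sum_const, Finset.card_univ, Fintype.card_fin, nsmul_eq_mul]
      field_simp
    refine ⟨_, Finset.mem_image.2 ⟨g, (hS g).2 ?_, rfl⟩, h5⟩
    have h6 : ∑ i, ((g i : ℝ) / (2 * √m)) * ((g i : ℝ) / (2 * √m)) 
        ≤ 2 * (v ⬝ᵥ v) + 2 * (1 / 16) := by
      refine le_trans ?_ (add_le_add_right (mul_le_mul_of_nonneg_left h5 zero_le_two) _)
      rw [dotProduct, Finset.mul_sum, Finset.mul_sum, ← Finset.sum_add_distrib]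
      refine Finset.sum_le_sum fun i _ => ?_
      nlinarith [sq_nonneg (2 * v i - (g i : ℝ) / (2 * √m))]
    rw [hz, hv, div_le_iff₀ (by positivity)] at h6
    have h7 : (∑ i, (g i : ℝ) ^ 2) ≤ 9 * m := by linarith
    exact_mod_cast h7

/-- The trace of an even power of a symmetric matrix is controlled by its quadratic form on a
net. -/
theorem trace_pow_le_sum_net {m : ℕ} {M : Matrix (Fin m) (Fin m) ℝ} (hM : M.IsHermitian)
    {N : Finset (Fin m → ℝ)} (hN1 : ∀ z ∈ N, z ⬝ᵥ z ≤ 9 / 4)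
    (hN2 : ∀ v : Fin m → ℝ, v ⬝ᵥ v = 1 → ∃ z ∈ N, (v - z) ⬝ᵥ (v - z) ≤ 1 / 16) (k : ℕ) :
    (M ^ (2 * k)).trace ≤ m * ∑ z ∈ N, (3 * (z ⬝ᵥ M *ᵥ z)) ^ (2 * k) := by
  rcases Nat.eq_zero_or_pos m with rfl | hm
  · simp [Matrix.trace]
  obtain ⟨i, -, hi⟩ := Finset.exists_max_image Finset.univ (fun i => |hM.eigenvalues i|)
    ⟨⟨0, hm⟩, Finset.mem_univ _⟩
  set ρ := |hM.eigenvalues i|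
  have hρ0 : 0 ≤ ρ := abs_nonneg _
  have hmax : ∀ j, |hM.eigenvalues j| ≤ ρ := fun j => hi j (Finset.mem_univ j)
  set v := eigenvec hM i with hv
  have hv1 : v ⬝ᵥ v = 1 := eigenvec_dotProduct_self hM i
  have hvM : v ⬝ᵥ M *ᵥ v = hM.eigenvalues i := by
    rw [hv, eigenvec_dotProduct_mulVec, eigenvec_dotProduct_self, mul_one]
  obtain ⟨z, hzN, hz⟩ := hN2 v hv1
  have hsymm : z ⬝ᵥ M *ᵥ v = v ⬝ᵥ M *ᵥ z := by
    rw [dotProduct_mulVec_eq_sum_eigenvec hM, dotProduct_mulVec_eq_sum_eigenvec hM]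
    exact Finset.sum_congr rfl fun j _ => by ring
  -- By symmetry the difference of the two values of the form factors, and `|v - z| |v + z| < 1`.
  have hdiff : v ⬝ᵥ M *ᵥ v - z ⬝ᵥ M *ᵥ z = (v - z) ⬝ᵥ M *ᵥ (v + z) := by
    rw [mulVec_add, dotProduct_add, sub_dotProduct, sub_dotProduct, hsymm]
    ring
  have hsum : (v + z) ⬝ᵥ (v + z) ≤ 13 / 2 := by
    have h1 := hN1 z hzN
    have h2 : 0 ≤ (v - z) ⬝ᵥ (v - z) := Finset.sum_nonneg fun i _ => mul_self_nonneg _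
    have h3 : (v + z) ⬝ᵥ (v + z) + (v - z) ⬝ᵥ (v - z) = 2 * (v ⬝ᵥ v) + 2 * (z ⬝ᵥ z) := by
      simp only [add_dotProduct, sub_dotProduct, dotProduct_add, dotProduct_sub]
      ring
    linarith
  have hsq : (v ⬝ᵥ M *ᵥ v - z ⬝ᵥ M *ᵥ z) ^ 2 ≤ (2 / 3 * ρ) ^ 2 := by
    rw [hdiff]
    refine (dotProduct_mulVec_sq_le hM hmax _ _).trans ?_
    have h1 : 0 ≤ (v + z) ⬝ᵥ (v + z) := Finset.sum_nonneg fun i _ => mul_self_nonneg _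
    have h2 : (v - z) ⬝ᵥ (v - z) * ((v + z) ⬝ᵥ (v + z)) ≤ 1 / 16 * (13 / 2) :=
      mul_le_mul hz hsum h1 (by norm_num)
    nlinarith [sq_nonneg ρ]
  have hle : ρ ≤ |3 * (z ⬝ᵥ M *ᵥ z)| := by
    have h1 := abs_le_of_sq_le_sq hsq (by positivity)
    rw [hvM] at h1
    have h2 := abs_sub_abs_le_abs_sub (hM.eigenvalues i) (z ⬝ᵥ M *ᵥ z)
    rw [abs_mul, abs_of_pos (by norm_num : (0 : ℝ) < 3)]
    linarith
  rw [trace_pow_eq_sum_eigenvalues_pow hM]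
  calc ∑ j, hM.eigenvalues j ^ (2 * k) ≤ ∑ _j : Fin m, ρ ^ (2 * k) := by
        refine Finset.sum_le_sum fun j _ => ?_
        rw [← (even_two_mul k).pow_abs]
        exact pow_le_pow_left₀ (abs_nonneg _) (hmax j) _
    _ = m * ρ ^ (2 * k) := by simp
    _ ≤ m * (3 * (z ⬝ᵥ M *ᵥ z)) ^ (2 * k) := by
        rw [← (even_two_mul k).pow_abs (3 * (z ⬝ᵥ M *ᵥ z))]
        gcongr
    _ ≤ _ := by
        gcongr
        exact Finset.single_le_sum (f := fun z => (3 * (z ⬝ᵥ M *ᵥ z)) ^ (2 * k))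
          (fun z _ => (even_two_mul k).pow_nonneg _) hzN

end Net

/-! ### Counting doubled walks through a comparison matrix -/

section SubGaussian

variable {Ω : Type*} [MeasurableSpace Ω] {μ : Measure Ω}

theorem integral_pow_le_of_hasSubgaussianMGF {S : Ω → ℝ} {c : NNReal}
    (hS : HasSubgaussianMGF S c μ) {C : ℝ} (hC : (c : ℝ) ≤ C) {k : ℕ} (hk : 0 < k) :
    ∫ ω, S ω ^ (2 * k) ∂μ ≤ 2 * (4 * Real.exp (C / 2) * k) ^ k := by
  have hk' : (0 : ℝ) < k := by exact_mod_cast hk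
  have hs : √(k : ℝ) ^ 2 = k := Real.sq_sqrt hk'.le
  -- The parameter `√k` of the moment generating function is optimal up to constants.
  have hpt : ∀ ω, S ω ^ (2 * k) ≤ ((2 * k).factorial / (k : ℝ) ^ k) *
      (Real.exp (√k * S ω) + Real.exp (-√k * S ω)) := by
    intro ω
    have h1 := Real.pow_div_factorial_le_exp _ (abs_nonneg (√(k : ℝ) * S ω)) (2 * k)
    rw [(even_two_mul k).pow_abs, mul_pow, pow_mul, hs] at h1
    have h2 : Real.exp |√(k : ℝ) * S ω| ≤ Real.exp (√k * S ω) + Real.exp (-√k * S ω) := by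
      rcases abs_cases (√(k : ℝ) * S ω) with ⟨h, -⟩ | ⟨h, -⟩
      · rw [h]
        linarith [Real.exp_pos (-√(k : ℝ) * S ω)]
      · rw [h, ← neg_mul]
        linarith [Real.exp_pos (√(k : ℝ) * S ω)]
    have h3 := h1.trans h2
    rw [div_le_iff₀ (by positivity)] at h3
    rw [div_mul_eq_mul_div, le_div_iff₀ (by positivity)]
    linarith
  have hi1 := hS.integrable_exp_mul √k
  have hi2 := hS.integrable_exp_mul (-√k)
  have hm1 : ∫ ω, Real.exp (√k * S ω) ∂μ ≤ Real.exp (C / 2) ^ k := by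
    refine (hS.mgf_le √k).trans ?_
    rw [← Real.exp_nat_mul, hs]
    exact Real.exp_le_exp.2 (by nlinarith)
  have hm2 : ∫ ω, Real.exp (-√k * S ω) ∂μ ≤ Real.exp (C / 2) ^ k := by
    refine (hS.mgf_le (-√k)).trans ?_
    rw [← Real.exp_nat_mul, neg_sq, hs]
    exact Real.exp_le_exp.2 (by nlinarith)
  calc ∫ ω, S ω ^ (2 * k) ∂μ ≤ ∫ ω, ((2 * k).factorial / (k : ℝ) ^ k) *
        (Real.exp (√k * S ω) + Real.exp (-√k * S ω)) ∂μ :=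
        integral_mono_of_nonneg (ae_of_all _ fun ω => (even_two_mul k).pow_nonneg _)
          ((hi1.add hi2).const_mul _) (ae_of_all _ hpt)
    _ = ((2 * k).factorial / (k : ℝ) ^ k) *
        (∫ ω, Real.exp (√k * S ω) ∂μ + ∫ ω, Real.exp (-√k * S ω) ∂μ) := by
        rw [integral_const_mul, integral_add hi1 hi2]
    _ ≤ ((2 * k : ℝ) ^ (2 * k) / (k : ℝ) ^ k) * (Real.exp (C / 2) ^ k + Real.exp (C / 2) ^ k) := by
        gcongr
        exact_mod_cast Nat.factorial_le_pow (2 * k)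
    _ = 2 * (4 * Real.exp (C / 2) * k) ^ k := by
        have h : ((2 * k : ℝ) ^ (2 * k) / (k : ℝ) ^ k) = (4 * k : ℝ) ^ k := by
          rw [div_eq_iff (by positivity), pow_mul, ← mul_pow]
          ring
        rw [h, ← two_mul, mul_left_comm, ← mul_pow]
        ring

end SubGaussian

section Quadratic

open Matrix

variable {n : ℕ}

theorem sum_ite_lt_eq_sum_edge (g : Fin n × Fin n → ℝ) :
    ∑ p : Fin n × Fin n, (if p.1 < p.2 then g p else 0) = ∑ e : Edge n, g e.1 := by
  rw [← Finset.sum_filter, ← Finset.sum_subtype_eq_sum_filter, Finset.subtype_univ]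

theorem dotProduct_edgeMatrix_mulVec (z : Edge n → ℝ) (x : Fin n → ℝ) :
    x ⬝ᵥ edgeMatrix z *ᵥ x = ∑ e : Edge n, 2 * (x e.1.1 * x e.1.2) * z e := by
  let g : Fin n × Fin n → ℝ := fun p => x p.1 * x p.2 * edgeMatrix z p.1 p.2
  have h1 : x ⬝ᵥ edgeMatrix z *ᵥ x = ∑ p, g p := by
    simp only [dotProduct, mulVec, Finset.mul_sum, Fintype.sum_prod_type, g]
    exact Finset.sum_congr rfl fun i _ => Finset.sum_congr rfl fun j _ => by ring
  have h2 : ∀ p, g p = (if p.1 < p.2 then g p else 0) + (if p.2 < p.1 then g p.swap else 0) := by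
    rintro ⟨i, j⟩
    have hs : edgeMatrix z j i = edgeMatrix z i j := (edgeMatrix_isHermitian z).apply i j
    rcases lt_trichotomy i j with h | h | h
    · simp [h, h.not_gt]
    · subst h
      simp [g, edgeMatrix_self]
    · simp only [g, h, h.not_gt, if_true, if_false, zero_add, Prod.fst_swap, Prod.snd_swap, hs]
      ring
  have h3 : ∑ p : Fin n × Fin n, (if p.2 < p.1 then g p.swap else 0)
      = ∑ p : Fin n × Fin n, if p.1 < p.2 then g p else 0 :=
    (Equiv.prodComm (Fin n) (Fin n)).sum_comp fun p => if p.1 < p.2 then g p else 0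
  have h4 := sum_ite_lt_eq_sum_edge g
  rw [h1, Finset.sum_congr rfl fun p _ => h2 p, Finset.sum_add_distrib, h3, h4, ← two_mul,
    Finset.mul_sum]
  refine Finset.sum_congr rfl fun e _ => ?_
  have : edgeMatrix z e.1.1 e.1.2 = z e := edgeMatrix_apply_of_toSym2_eq z rfl
  simp only [g, this]
  ring

theorem sum_edge_sq_le (x : Fin n → ℝ) :
    ∑ e : Edge n, (2 * (x e.1.1 * x e.1.2)) ^ 2 ≤ 4 * (x ⬝ᵥ x) ^ 2 := by
  let g : Fin n × Fin n → ℝ := fun p => (2 * (x p.1 * x p.2)) ^ 2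
  have h4 := sum_ite_lt_eq_sum_edge g
  have h5 : ∑ p : Fin n × Fin n, g p = 4 * (x ⬝ᵥ x) ^ 2 := by
    rw [sq (x ⬝ᵥ x), dotProduct, Finset.sum_mul_sum, Fintype.sum_prod_type, Finset.mul_sum]
    refine Finset.sum_congr rfl fun i _ => ?_
    rw [Finset.mul_sum]
    exact Finset.sum_congr rfl fun j _ => by ring
  change ∑ e : Edge n, g e.1 ≤ _
  rw [← h4, ← h5]
  refine Finset.sum_le_sum fun p _ => ?_
  split_ifs
  · exact le_rfl
  · exact sq_nonneg _

end Quadratic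

section Model

open Matrix

/-- The comparison variable: `2` with probability `1 / 3` and `-1` with probability `2 / 3`. It is
bounded and centred, and all its other moments are at least `1`. -/
noncomputable def comparisonVar (b : Bool) : ℝ := if b then 2 else -1

/-- The law of the coin underlying `comparisonVar`. -/
noncomputable def comparisonMeasure : Measure Bool :=
  ENNReal.ofReal (1 / 3) • Measure.dirac true + ENNReal.ofReal (2 / 3) • Measure.dirac false

instance : IsProbabilityMeasure comparisonMeasure := by
  constructor
  simp only [comparisonMeasure, Measure.coe_add, Measure.coe_smul, Pi.add_apply, Pi.smul_apply,
    measure_univ, smul_eq_mul, mul_one]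
  rw [← ENNReal.ofReal_add (by norm_num) (by norm_num)]
  norm_num

theorem integral_comparisonVar_pow (j : ℕ) :
    ∫ b, comparisonVar b ^ j ∂comparisonMeasure = 1 / 3 * 2 ^ j + 2 / 3 * (-1) ^ j := by
  have hi : ∀ (b : Bool) (c : ℝ), Integrable (fun b => comparisonVar b ^ j)
      (ENNReal.ofReal c • Measure.dirac b) := fun b c =>
    Integrable.smul_measure .of_finite ENNReal.ofReal_ne_top
  rw [comparisonMeasure, integral_add_measure (hi _ _) (hi _ _), integral_smul_measure,
    integral_smul_measure, integral_dirac, integral_dirac,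
    ENNReal.toReal_ofReal (by norm_num), ENNReal.toReal_ofReal (by norm_num)]
  simp [comparisonVar]

theorem one_le_integral_comparisonVar_pow {j : ℕ} (hj : j ≠ 1) :
    1 ≤ ∫ b, comparisonVar b ^ j ∂comparisonMeasure := by
  rw [integral_comparisonVar_pow]
  match j, hj with
  | 0, _ => norm_num
  | 2, _ => norm_num
  | j + 3, _ =>
    have h1 : (1 : ℝ) ≤ 2 ^ j := one_le_pow₀ one_le_two
    have h2 := neg_one_pow_eq_or ℝ (j + 3)
    rw [pow_add]
    rcases h2 with h | h <;> rw [← pow_add, h, pow_add] <;> linarith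

theorem integral_comparisonVar : ∫ b, comparisonVar b ∂comparisonMeasure = 0 := by
  have h := integral_comparisonVar_pow 1
  simp only [pow_one] at h
  rw [h]
  norm_num

theorem abs_comparisonVar_le (b : Bool) : |comparisonVar b| ≤ 2 := by
  cases b <;> norm_num [comparisonVar]

/-- The number of doubled closed walks of length `2 k` on `2 k` vertices is at most `k (C k) ^ k`:
it is bounded by the expected trace of the `2 k`-th power of a matrix with independent copies of
`comparisonVar` as entries, whose operator norm is of order `√k` by a net argument. -/
theorem exists_sum_isDoubledWalk_le : ∃ C : ℝ, 0 < C ∧ ∀ k : ℕ, 0 < k →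
    (open Classical in ∑ w : Fin (2 * k + 1) → Fin (2 * k), if IsDoubledWalk w then (1 : ℝ) else 0)
      ≤ k * (C * k) ^ k := by
  obtain ⟨D, hD1, hD⟩ := exists_net
  refine ⟨4 * D ^ 2 * 9 * (4 * Real.exp (46 / 2)), by positivity, fun k hk => ?_⟩
  obtain ⟨N, hNcard, hN1, hN2⟩ := hD (2 * k)
  let μ : Measure (Edge (2 * k) → Bool) := Measure.pi fun _ => comparisonMeasure
  let Z : Edge (2 * k) → (Edge (2 * k) → Bool) → ℝ := fun e ω => comparisonVar (ω e)
  have hmeas : Measurable comparisonVar := Measurable.of_discrete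
  have hZm : ∀ e, Measurable (Z e) := fun e => hmeas.comp (measurable_pi_apply e)
  have hZ : iIndepFun Z μ := iIndepFun_pi (X := fun _ => comparisonVar) fun _ => hmeas.aemeasurable
  have hZB : ∀ e ω, |Z e ω| ≤ 2 := fun e ω => abs_comparisonVar_le _
  have hint : ∀ (e : Edge (2 * k)) (f : Bool → ℝ),
      ∫ ω, f (ω e) ∂μ = ∫ b, f b ∂comparisonMeasure := fun e f =>
    integral_comp_eval (μ := fun _ : Edge (2 * k) => comparisonMeasure)
      Measurable.of_discrete.aestronglyMeasurable
  have hZ1 : ∀ e, ∀ j, j ≠ 1 → 1 ≤ ∫ ω, Z e ω ^ j ∂μ := fun e j hj => by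
    rw [hint e fun b => comparisonVar b ^ j]
    exact one_le_integral_comparisonVar_pow hj
  have hZ0' : ∀ e, ∫ ω, Z e ω ∂μ = 0 := fun e => by
    rw [hint e comparisonVar, integral_comparisonVar]
  have hZ0 : ∀ e, ∀ j, 0 ≤ ∫ ω, Z e ω ^ j ∂μ := fun e j => by
    by_cases hj : j = 1
    · simp only [hj, pow_one, hZ0', le_refl]
    · exact zero_le_one.trans (hZ1 e j hj)
  have hsub : ∀ e, HasSubgaussianMGF (Z e) ((‖(2 : ℝ) - (-1)‖₊ / 2) ^ 2) μ := fun e =>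
    hasSubgaussianMGF_of_mem_Icc_of_integral_eq_zero (hZm e).aemeasurable
      (ae_of_all _ fun ω => by
        change comparisonVar (ω e) ∈ _
        cases ω e <;> norm_num [comparisonVar]) (hZ0' e)
  have hquad : ∀ z ∈ N, Integrable (fun ω => (z ⬝ᵥ edgeMatrix (fun e => Z e ω) *ᵥ z) ^ (2 * k)) μ ∧
      ∫ ω, (z ⬝ᵥ edgeMatrix (fun e => Z e ω) *ᵥ z) ^ (2 * k) ∂μ
        ≤ 2 * (4 * Real.exp (46 / 2) * k) ^ k := by
    intro z hz
    simp_rw [dotProduct_edgeMatrix_mulVec]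
    let a : Edge (2 * k) → ℝ := fun e => 2 * (z e.1.1 * z e.1.2)
    have hind : iIndepFun (fun e ω => a e * Z e ω) μ :=
      hZ.comp (fun e x => a e * x) fun e => measurable_const_mul _
    have hc : ∀ e, HasSubgaussianMGF (fun ω => a e * Z e ω) (a e ^ 2 * (9 / 4)).toNNReal μ := by
      intro e
      convert! (hsub e).const_mul (a e) using 1
      apply NNReal.coe_injective
      have h : ‖(2 : ℝ) - (-1)‖ = 3 := by norm_num
      rw [Real.coe_toNNReal _ (by positivity)]
      change _ = a e ^ 2 * (‖(2 : ℝ) - (-1)‖ / 2) ^ 2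
      rw [h]
      norm_num
    have hS := HasSubgaussianMGF.sum_of_iIndepFun hind (s := Finset.univ) fun e _ => hc e
    refine ⟨Integrable.of_finite, integral_pow_le_of_hasSubgaussianMGF hS ?_ hk⟩
    have h1 := sum_edge_sq_le z
    have h2 := hN1 z hz
    have h3 : 0 ≤ z ⬝ᵥ z := Finset.sum_nonneg fun i _ => mul_self_nonneg _
    rw [NNReal.coe_sum]
    simp_rw [fun e => Real.coe_toNNReal (a e ^ 2 * (9 / 4)) (by positivity)]
    rw [← Finset.sum_mul]
    nlinarith
  refine (sum_isDoubledWalk_le_integral_trace hZ hZm hZB hZ0 hZ1 (2 * k)).trans ?_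
  have h1 : ∫ ω, (edgeMatrix (fun e => Z e ω) ^ (2 * k)).trace ∂μ
      ≤ ∫ ω, ((2 * k : ℕ) : ℝ) * ∑ z ∈ N,
        9 ^ k * (z ⬝ᵥ edgeMatrix (fun e => Z e ω) *ᵥ z) ^ (2 * k) ∂μ := by
    refine integral_mono .of_finite .of_finite fun ω => ?_
    refine (trace_pow_le_sum_net (edgeMatrix_isHermitian _) hN1 hN2 k).trans (le_of_eq ?_)
    simp only [mul_pow, pow_mul]
    norm_num
  refine h1.trans ?_
  rw [integral_const_mul, integral_finsetSum _ fun z hz => (hquad z hz).1.const_mul _]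
  simp_rw [integral_const_mul]
  calc ((2 * k : ℕ) : ℝ) * ∑ z ∈ N,
        9 ^ k * ∫ ω, (z ⬝ᵥ edgeMatrix (fun e => Z e ω) *ᵥ z) ^ (2 * k) ∂μ
      ≤ ((2 * k : ℕ) : ℝ) * ∑ _z ∈ N, 9 ^ k * (2 * (4 * Real.exp (46 / 2) * k) ^ k) := by
        gcongr with z hz
        exact (hquad z hz).2
    _ = (4 * k) * (N.card * (9 ^ k * (4 * Real.exp (46 / 2) * k) ^ k)) := by
        rw [Finset.sum_const, nsmul_eq_mul]
        push_cast
        ring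
    _ ≤ (4 ^ k * k) * (D ^ (2 * k) * (9 ^ k * (4 * Real.exp (46 / 2) * k) ^ k)) := by
        gcongr
        exact le_self_pow₀ (by norm_num) hk.ne'
    _ = k * (4 * D ^ 2 * 9 * (4 * Real.exp (46 / 2)) * k) ^ k := by
        simp only [mul_pow, ← pow_mul]
        ring

end Model

/-! ### Concentration of the noise -/

section Noise

open Matrix

/-- The quadratic form of a random symmetric matrix with independent centred bounded entries of
variance at most `σ2` is `O(√(n σ2))`, provided that `n σ2 ≥ log n`. -/
theorem exists_noise_bound : ∃ C : ℝ, 0 < C ∧ ∀ (n : ℕ) (σ2 : ℝ), 0 < n → σ2 ≤ 1 → 1 ≤ n * σ2 →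
    Real.log n ≤ n * σ2 → ∀ {Ω : Type*} [MeasurableSpace Ω] (μ : Measure Ω) (Z : Edge n → Ω → ℝ),
    iIndepFun Z μ → (∀ e, Measurable (Z e)) → (∀ e ω, |Z e ω| ≤ 1) →
    (∀ e, ∫ ω, Z e ω ∂μ = 0) → (∀ e, ∫ ω, Z e ω ^ 2 ∂μ ≤ σ2) →
    ∃ s : Set Ω, 1 - 1 / (n : ℝ) ^ 8 ≤ μ.real s ∧ ∀ ω ∈ s, ∀ x : Fin n → ℝ,
      |x ⬝ᵥ edgeMatrix (fun e => Z e ω) *ᵥ x| ≤ C * √(n * σ2) * (x ⬝ᵥ x) := by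
  obtain ⟨C, hC0, hC⟩ := exists_sum_isDoubledWalk_le
  refine ⟨√(2 * C * Real.exp 9), by positivity, ?_⟩
  intro n σ2 hn hσ1 h1 hlog Ω _ μ Z hZ hm hB hZ0 hZ2
  have := hZ.isProbabilityMeasure
  have hn' : (0 : ℝ) < n := by exact_mod_cast hn
  have hσ0 : 0 < σ2 := by
    by_contra hneg
    push Not at hneg
    nlinarith
  -- The order of the moment is taken of the size of the variance proxy `n σ2`.
  set k := ⌈n * σ2⌉₊ with hkdef
  have hk : 0 < k := Nat.ceil_pos.2 (by linarith)
  have hk' : (0 : ℝ) < k := by exact_mod_cast hk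
  have hk1 : n * σ2 ≤ k := Nat.le_ceil _
  have hk2 : (k : ℝ) ≤ 2 * (n * σ2) := by
    have := Nat.ceil_lt_add_one (a := n * σ2) (by linarith)
    linarith
  have hmom : ∀ e, ∀ j, 2 ≤ j → |∫ ω, Z e ω ^ j ∂μ| ≤ σ2 := by
    intro e j hj
    refine (abs_integral_le_integral_abs).trans (le_trans ?_ (hZ2 e))
    refine integral_mono_of_nonneg (ae_of_all _ fun ω => abs_nonneg _) ?_ (ae_of_all _ fun ω => ?_)
    · refine Integrable.of_bound (C := 1) ((hm e).pow_const 2).aestronglyMeasurable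
        (ae_of_all _ fun ω => ?_)
      rw [Real.norm_eq_abs, abs_pow]
      exact pow_le_one₀ (abs_nonneg _) (hB e ω)
    · change |Z e ω ^ j| ≤ Z e ω ^ 2
      rw [abs_pow, ← sq_abs (Z e ω)]
      exact pow_le_pow_of_le_one (abs_nonneg _) (hB e ω) hj
  let T : Ω → ℝ := fun ω => (edgeMatrix (fun e => Z e ω) ^ (2 * k)).trace
  have hTint : Integrable T μ := (integral_trace_edgeMatrix_pow hZ hm hB (2 * k)).1
  have hT0 : ∀ ω, 0 ≤ T ω := fun ω => by
    change 0 ≤ (edgeMatrix (fun e => Z e ω) ^ (2 * k)).trace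
    rw [trace_pow_eq_sum_eigenvalues_pow (edgeMatrix_isHermitian _)]
    exact Finset.sum_nonneg fun i _ => (even_two_mul k).pow_nonneg _
  have hET : ∫ ω, T ω ∂μ ≤ n * (C * k) ^ k := by
    calc ∫ ω, T ω ∂μ ≤ _ := integral_trace_edgeMatrix_pow_le hZ hm hB hσ0.le hσ1 hZ0 hmom (2 * k)
      _ ≤ _ := sum_isDoubledWalk_pow_le n k σ2 hσ0.le hk hk1
      _ ≤ (n / k : ℝ) * (k * (C * k) ^ k) := by
          gcongr
          exact hC k hk
      _ = n * (C * k) ^ k := by field_simp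
  set η := √(C * Real.exp 9 * k) with hη
  have hηpow : η ^ (2 * k) = (C * k) ^ k * Real.exp 9 ^ k := by
    rw [pow_mul, hη, Real.sq_sqrt (by positivity), ← mul_pow]
    ring
  have hexp : (n : ℝ) ^ 9 ≤ Real.exp 9 ^ k := by
    rw [← Real.exp_nat_mul, ← Real.exp_log hn', ← Real.exp_nat_mul, Real.exp_le_exp]
    push_cast
    linarith
  refine ⟨{ω | T ω < η ^ (2 * k)}, ?_, ?_⟩
  · have hmarkov := mul_meas_ge_le_integral_of_nonneg (ae_of_all μ hT0) hTint (η ^ (2 * k))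
    have hbad : μ.real {ω | η ^ (2 * k) ≤ T ω} ≤ 1 / (n : ℝ) ^ 8 := by
      have h2 := hmarkov.trans hET
      rw [hηpow, mul_assoc, mul_comm (n : ℝ), mul_le_mul_iff_of_pos_left (by positivity)] at h2
      rw [← hηpow] at h2
      rw [le_div_iff₀ (by positivity)]
      have h3 : (n : ℝ) ^ 9 * μ.real {ω | η ^ (2 * k) ≤ T ω} ≤ n :=
        (mul_le_mul_of_nonneg_right hexp measureReal_nonneg).trans h2
      have h4 : n * (μ.real {ω | η ^ (2 * k) ≤ T ω} * (n : ℝ) ^ 8) ≤ n * 1 := by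
        rw [mul_one]
        refine le_trans (le_of_eq ?_) h3
        ring
      exact le_of_mul_le_mul_left h4 hn'
    have hcover : μ.real Set.univ
        ≤ μ.real {ω | T ω < η ^ (2 * k)} + μ.real {ω | η ^ (2 * k) ≤ T ω} := by
      refine (measureReal_mono fun ω _ => ?_).trans (measureReal_union_le _ _)
      exact lt_or_ge (T ω) (η ^ (2 * k))
    rw [probReal_univ] at hcover
    linarith
  · intro ω hω x
    refine (abs_dotProduct_mulVec_le_of_trace_pow_lt (edgeMatrix_isHermitian _)
      (Real.sqrt_nonneg _) hω x).trans ?_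
    refine mul_le_mul_of_nonneg_right ?_ (Finset.sum_nonneg fun i _ => mul_self_nonneg _)
    rw [← Real.sqrt_mul (by positivity)]
    refine Real.sqrt_le_sqrt ?_
    have : 0 < C * Real.exp 9 := by positivity
    nlinarith

end Noise

/-! ### Eigenvalues of the adjacency matrix -/

section MinMax

open Matrix

variable {n : ℕ} {A : Matrix (Fin n) (Fin n) ℝ}

/-- The eigenvector of the `j`-th largest eigenvalue, counted from `0`. -/
noncomputable def orderedEigenvec (hA : A.IsHermitian) (j : Fin (Fintype.card (Fin n))) :
    Fin n → ℝ := eigenvec hA ((Fintype.equivOfCardEq (Fintype.card_fin _)) j)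

theorem dotProduct_mulVec_eq_sum_ordered (hA : A.IsHermitian) (x : Fin n → ℝ) :
    x ⬝ᵥ A *ᵥ x = ∑ j, hA.eigenvalues₀ j * (orderedEigenvec hA j ⬝ᵥ x) ^ 2 := by
  rw [dotProduct_mulVec_eq_sum_eigenvec hA,
    ← (Fintype.equivOfCardEq (Fintype.card_fin (Fintype.card (Fin n)))).sum_comp]
  refine Finset.sum_congr rfl fun j _ => ?_
  rw [Matrix.IsHermitian.eigenvalues, Equiv.symm_apply_apply, orderedEigenvec]
  ring

theorem dotProduct_self_eq_sum_ordered (hA : A.IsHermitian) (x : Fin n → ℝ) :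
    x ⬝ᵥ x = ∑ j, (orderedEigenvec hA j ⬝ᵥ x) ^ 2 := by
  rw [dotProduct_eq_sum_eigenvec hA,
    ← (Fintype.equivOfCardEq (Fintype.card_fin (Fintype.card (Fin n)))).sum_comp]
  refine Finset.sum_congr rfl fun j _ => ?_
  rw [orderedEigenvec]
  ring

theorem orderedEigenvec_dotProduct (hA : A.IsHermitian) (i j : Fin (Fintype.card (Fin n))) :
    orderedEigenvec hA i ⬝ᵥ orderedEigenvec hA j = if i = j then 1 else 0 := by
  split_ifs with h
  · rw [h]
    exact eigenvec_dotProduct_self hA _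
  · exact eigenvec_dotProduct_of_ne hA fun e => h (Equiv.injective _ e)

/-- If the quadratic form is at least `a` on the injective image of a `(j + 1)`-dimensional space,
then so is the `j`-th largest eigenvalue, counted from `0`. -/
theorem le_eigenvalues₀ (hA : A.IsHermitian) (j : Fin (Fintype.card (Fin n))) {m : ℕ}
    (hjm : j.1 < m)
    (ψ : (Fin m → ℝ) →ₗ[ℝ] (Fin n → ℝ)) (hψ : Function.Injective ψ) {a : ℝ}
    (ha : ∀ y, a * (ψ y ⬝ᵥ ψ y) ≤ ψ y ⬝ᵥ A *ᵥ ψ y) : a ≤ hA.eigenvalues₀ j := by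
  let f : (Fin m → ℝ) →ₗ[ℝ] (Fin j.1 → ℝ) :=
    (LinearMap.pi fun i => dotProductBilin ℝ ℝ (orderedEigenvec hA (i.castLE j.2.le))) ∘ₗ ψ
  -- Some nonzero vector of the image is orthogonal to the `j` leading eigenvectors.
  have hker : f.ker ≠ ⊥ := LinearMap.ker_ne_bot_of_finrank_lt (by simpa using hjm)
  obtain ⟨y, hy, hy0⟩ := Submodule.exists_mem_ne_zero_of_ne_bot hker
  have hx0 : ψ y ≠ 0 := fun h => hy0 (hψ (h.trans (map_zero ψ).symm))
  have horth : ∀ i : Fin (Fintype.card (Fin n)), i < j → orderedEigenvec hA i ⬝ᵥ ψ y = 0 :=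
    fun i hi => congrFun (LinearMap.mem_ker.1 hy) ⟨i.1, hi⟩
  have hpos : 0 < ψ y ⬝ᵥ ψ y := lt_of_le_of_ne
    (Finset.sum_nonneg fun i _ => mul_self_nonneg _) fun h => hx0 (dotProduct_self_eq_zero.1 h.symm)
  refine le_of_mul_le_mul_right ((ha y).trans ?_) hpos
  rw [dotProduct_mulVec_eq_sum_ordered hA, dotProduct_self_eq_sum_ordered hA, Finset.mul_sum]
  refine Finset.sum_le_sum fun i _ => ?_
  rcases lt_or_ge i j with h | h
  · simp [horth i h]
  · exact mul_le_mul_of_nonneg_right (hA.eigenvalues₀_antitone h) (sq_nonneg _)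

/-- If the quadratic form is at most `a` on a subspace cut out by `j` linear equations, then so is
the `j`-th largest eigenvalue, counted from `0`. -/
theorem eigenvalues₀_le (hA : A.IsHermitian) (j : Fin (Fintype.card (Fin n))) {m : ℕ}
    (hjm : m ≤ j.1)
    (φ : (Fin n → ℝ) →ₗ[ℝ] (Fin m → ℝ)) {a : ℝ}
    (ha : ∀ x, φ x = 0 → x ⬝ᵥ A *ᵥ x ≤ a * (x ⬝ᵥ x)) : hA.eigenvalues₀ j ≤ a := by
  let b : Fin (j.1 + 1) → Fin n → ℝ := fun i => orderedEigenvec hA (i.castLE j.2)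
  let f : (Fin (j.1 + 1) → ℝ) →ₗ[ℝ] (Fin m → ℝ) := φ ∘ₗ Fintype.linearCombination ℝ b
  -- Some nonzero combination of the `j + 1` leading eigenvectors satisfies the equations.
  have hker : f.ker ≠ ⊥ := LinearMap.ker_ne_bot_of_finrank_lt (by simp; omega)
  obtain ⟨y, hy, hy0⟩ := Submodule.exists_mem_ne_zero_of_ne_bot hker
  set x := Fintype.linearCombination ℝ b y with hx
  have hφ : φ x = 0 := LinearMap.mem_ker.1 hy
  have hcoord : ∀ i, orderedEigenvec hA i ⬝ᵥ x
      = ∑ l : Fin (j.1 + 1), y l * if i = l.castLE j.2 then 1 else 0 := by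
    intro i
    rw [hx, Fintype.linearCombination_apply, dotProduct_sum]
    refine Finset.sum_congr rfl fun l _ => ?_
    rw [dotProduct_smul, smul_eq_mul, orderedEigenvec_dotProduct]
  have hcoord1 : ∀ l : Fin (j.1 + 1), orderedEigenvec hA (l.castLE j.2) ⬝ᵥ x = y l := by
    intro l
    rw [hcoord, Finset.sum_eq_single l]
    · simp
    · intro l' _ hl'
      rw [if_neg, mul_zero]
      exact fun h => hl' (Fin.castLE_injective _ h).symm
    · simp
  have hcoord0 : ∀ i, j < i → orderedEigenvec hA i ⬝ᵥ x = 0 := by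
    intro i hi
    rw [hcoord]
    refine Finset.sum_eq_zero fun l _ => ?_
    rw [if_neg, mul_zero]
    rintro rfl
    have h1 : j.1 < l.1 := hi
    have h2 := l.2
    omega
  have hx0 : x ≠ 0 := by
    intro h
    refine hy0 (funext fun l => ?_)
    rw [← hcoord1 l, h, dotProduct_zero]
    rfl
  have hpos : 0 < x ⬝ᵥ x := lt_of_le_of_ne
    (Finset.sum_nonneg fun i _ => mul_self_nonneg _) fun h => hx0 (dotProduct_self_eq_zero.1 h.symm)
  refine le_of_mul_le_mul_right (le_trans ?_ (ha x hφ)) hpos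
  rw [dotProduct_mulVec_eq_sum_ordered hA, dotProduct_self_eq_sum_ordered hA, Finset.mul_sum]
  refine Finset.sum_le_sum fun i _ => ?_
  rcases lt_or_ge j i with h | h
  · simp [hcoord0 i h]
  · exact mul_le_mul_of_nonneg_right (hA.eigenvalues₀_antitone h) (sq_nonneg _)

end MinMax

section Mean

open Matrix

variable {n r : ℕ}

/-- The deviation of the indicator of an edge from its probability, for a given graph. -/
noncomputable def edgeNoise (c : Fin n → Fin r) (p q : ℝ) (G : SimpleGraph (Fin n)) (e : Edge n) :
    ℝ :=
  (open Classical in if G.Adj e.1.1 e.1.2 then 1 else 0) - if c e.1.1 = c e.1.2 then p else q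

theorem adjacency_apply_eq (c : Fin n → Fin r) (p q : ℝ) (G : SimpleGraph (Fin n)) (i j : Fin n) :
    adjacency G i j = (p - q) * (if c i = c j then 1 else 0) + q
      + (1 - p) * (if i = j then 1 else 0)
      + edgeMatrix (edgeNoise c p q G) i j := by
  have key : ∀ i j : Fin n, i < j → adjacency G i j
      = (p - q) * (if c i = c j then 1 else 0) + q + (1 - p) * (if i = j then 1 else 0)
      + edgeMatrix (edgeNoise c p q G) i j := by
    intro i j h
    rw [edgeMatrix_apply_of_toSym2_eq _ (e := ⟨(i, j), h⟩) rfl]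
    have ha : adjacency G i j = open Classical in if G.Adj i j then 1 else 0 := by
      by_cases hG : G.Adj i j <;> simp [adjacency, h.ne, hG]
    simp only [ha, edgeNoise, h.ne, if_false]
    split_ifs <;> ring
  rcases lt_trichotomy i j with h | rfl | h
  · exact key i j h
  · rw [edgeMatrix_self]
    simp [adjacency]
  · have h1 : adjacency G j i = adjacency G i j := (adjacency_isHermitian G).apply i j
    have h2 := (edgeMatrix_isHermitian (edgeNoise c p q G)).apply i j
    rw [← h1, key j i h]
    simp only [star_trivial] at h2
    simp only [h2, eq_comm]

theorem dotProduct_adjacency_mulVec (c : Fin n → Fin r) (p q : ℝ) (G : SimpleGraph (Fin n))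
    (x : Fin n → ℝ) :
    x ⬝ᵥ adjacency G *ᵥ x = (p - q) * ∑ a, (∑ i with c i = a, x i) ^ 2 + q * (∑ i, x i) ^ 2
      + (1 - p) * (x ⬝ᵥ x) + x ⬝ᵥ edgeMatrix (edgeNoise c p q G) *ᵥ x := by
  have h1 : ∑ a, (∑ i with c i = a, x i) ^ 2
      = ∑ i, ∑ j, x i * x j * (if c i = c j then 1 else 0) := by
    rw [← Finset.sum_fiberwise Finset.univ c]
    refine Finset.sum_congr rfl fun a _ => ?_
    rw [sq, Finset.sum_mul_sum]
    refine Finset.sum_congr rfl fun i hi => ?_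
    rw [Finset.sum_filter]
    refine Finset.sum_congr rfl fun j _ => ?_
    rw [(Finset.mem_filter.1 hi).2]
    by_cases h : c j = a
    · simp [h]
    · simp [h, Ne.symm h]
  have h2 : (∑ i, x i) ^ 2 = ∑ i, ∑ j, x i * x j := by rw [sq, Finset.sum_mul_sum]
  have h3 : x ⬝ᵥ x = ∑ i, ∑ j, x i * x j * (if i = j then 1 else 0) := by simp [dotProduct]
  rw [h1, h2, h3]
  simp only [dotProduct, mulVec, Finset.mul_sum, ← Finset.sum_add_distrib,
    adjacency_apply_eq c p q G]
  exact Finset.sum_congr rfl fun i _ => Finset.sum_congr rfl fun j _ => by ring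

theorem sum_cluster_sq_le {c : Fin n → Fin r} {K : ℕ}
    (hc : ∀ a : Fin r, (Finset.univ.filter fun i => c i = a).card = K) (x : Fin n → ℝ) :
    ∑ a, (∑ i with c i = a, x i) ^ 2 ≤ K * (x ⬝ᵥ x) := by
  rw [dotProduct, ← Finset.sum_fiberwise Finset.univ c, Finset.mul_sum]
  refine Finset.sum_le_sum fun a _ => ?_
  rw [← hc a]
  simpa only [sq] using
    sq_sum_le_card_mul_sum_sq (s := Finset.univ.filter fun i => c i = a) (f := x)

theorem sum_cluster_sq_eq {c : Fin n → Fin r} {K : ℕ}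
    (hc : ∀ a : Fin r, (Finset.univ.filter fun i => c i = a).card = K) (y : Fin r → ℝ) :
    ∑ a, (∑ i with c i = a, y (c i)) ^ 2 = K * ((fun i => y (c i)) ⬝ᵥ fun i => y (c i)) := by
  rw [dotProduct, ← Finset.sum_fiberwise Finset.univ c, Finset.mul_sum]
  refine Finset.sum_congr rfl fun a _ => ?_
  have h1 : ∑ i with c i = a, y (c i) = K * y a := by
    rw [Finset.sum_congr rfl fun i hi => by rw [(Finset.mem_filter.1 hi).2], Finset.sum_const, hc a,
      nsmul_eq_mul]
  have h2 : ∑ i with c i = a, y (c i) * y (c i) = K * (y a * y a) := by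
    rw [Finset.sum_congr rfl fun i hi => by rw [(Finset.mem_filter.1 hi).2], Finset.sum_const, hc a,
      nsmul_eq_mul]
  rw [h1, h2]
  ring

end Mean

section EigenvalueBounds

open Matrix

variable {n r K : ℕ} {c : Fin n → Fin r} {p q η : ℝ} {G : SimpleGraph (Fin n)}

theorem eig_eq {k : ℕ} (hk1 : 1 ≤ k) (hkn : k ≤ n) :
    ∃ j : Fin (Fintype.card (Fin n)), j.1 + 1 = k ∧
      eig G k = (adjacency_isHermitian G).eigenvalues₀ j := by
  have h : k - 1 < Fintype.card (Fin n) := by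
    rw [Fintype.card_fin]
    omega
  exact ⟨⟨k - 1, h⟩, by simp only; omega, by rw [eig, dif_pos h]⟩

/-- Apart from the noise, the adjacency matrix has the eigenvalue `K (p - q) + n q + (1 - p)` for
the constant vector, `K (p - q) + (1 - p)` on the vectors of sum zero that are constant on
clusters, and `1 - p` on the vectors that sum to zero on each cluster. -/
theorem abs_eig_sub_le (hc : ∀ a : Fin r, (Finset.univ.filter fun i => c i = a).card = K)
    (hn : n = r * K) (hr : 2 ≤ r) (hK : 1 ≤ K) (hq : 0 ≤ q) (hqp : q ≤ p)
    (hη : ∀ x : Fin n → ℝ, |x ⬝ᵥ edgeMatrix (edgeNoise c p q G) *ᵥ x| ≤ η * (x ⬝ᵥ x)) :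
    |eig G 1 - (K * (p - q) + n * q + (1 - p))| ≤ η ∧
    (∀ k, 2 ≤ k → k ≤ r → |eig G k - (K * (p - q) + (1 - p))| ≤ η) ∧
    (∀ k, r + 1 ≤ k → k ≤ n → |eig G k - (1 - p)| ≤ η) := by
  have hrn : r ≤ n := by
    rw [hn]
    exact Nat.le_mul_of_pos_right _ hK
  have hxx : ∀ x : Fin n → ℝ, 0 ≤ x ⬝ᵥ x := fun x => Finset.sum_nonneg fun i _ => mul_self_nonneg _
  have hcs : ∀ x : Fin n → ℝ, (∑ i, x i) ^ 2 ≤ n * (x ⬝ᵥ x) := fun x => by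
    simpa [sq, dotProduct] using sq_sum_le_card_mul_sum_sq (s := Finset.univ) (f := x)
  have hpq : 0 ≤ p - q := sub_nonneg.2 hqp
  have hsurj : ∀ a : Fin r, ∃ i, c i = a := fun a => by
    have h : 0 < (Finset.univ.filter fun i => c i = a).card := by
      rw [hc a]
      exact hK
    obtain ⟨i, hi⟩ := Finset.card_pos.1 h
    exact ⟨i, (Finset.mem_filter.1 hi).2⟩
  refine ⟨?_, fun k hk2 hkr => ?_, fun k hkr hkn => ?_⟩
  · obtain ⟨j, hj, he⟩ := eig_eq (G := G) le_rfl (by omega : 1 ≤ n)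
    rw [he, abs_le]
    constructor
    · have h := le_eigenvalues₀ (adjacency_isHermitian G) j (m := 1) (by omega)
        (a := K * (p - q) + n * q + (1 - p) - η)
        (LinearMap.pi fun _ => LinearMap.proj 0) (fun y y' hyy => ?_) fun y => ?_
      · linarith
      · ext a
        rw [Subsingleton.elim a 0]
        exact congrFun hyy ⟨0, by omega⟩
      · have h1 := sum_cluster_sq_eq hc (fun _ => y 0)
        have h2 := abs_le.1 (hη fun _ => y 0)
        change _ * ((fun _ : Fin n => y 0) ⬝ᵥ fun _ => y 0)
          ≤ (fun _ : Fin n => y 0) ⬝ᵥ adjacency G *ᵥ fun _ => y 0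
        rw [dotProduct_adjacency_mulVec c p q, h1]
        have h3 : (∑ _i : Fin n, y 0) ^ 2 = n * ((fun _ : Fin n => y 0) ⬝ᵥ fun _ => y 0) := by
          simp [dotProduct]
          ring
        rw [h3]
        linarith
    · have h := eigenvalues₀_le (adjacency_isHermitian G) j (m := 0) (by omega) 0
        (a := K * (p - q) + n * q + (1 - p) + η) fun x _ => ?_
      · linarith
      · have h1 := mul_le_mul_of_nonneg_left (sum_cluster_sq_le hc x) hpq
        have h2 := mul_le_mul_of_nonneg_left (hcs x) hq
        have h3 := (abs_le.1 (hη x)).2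
        rw [dotProduct_adjacency_mulVec c p q]
        linarith
  · obtain ⟨j, hj, he⟩ := eig_eq (G := G) (by omega : 1 ≤ k) (by omega)
    rw [he, abs_le]
    constructor
    · have h := le_eigenvalues₀ (adjacency_isHermitian G) j (m := r) (by omega)
        (a := K * (p - q) + (1 - p) - η)
        (LinearMap.funLeft ℝ ℝ c) (fun y y' hyy => ?_) fun y => ?_
      · linarith
      · ext a
        obtain ⟨i, rfl⟩ := hsurj a
        exact congrFun hyy i
      · have h1 := sum_cluster_sq_eq hc y
        have h2 := (abs_le.1 (hη fun i => y (c i))).1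
        have h3 := mul_nonneg hq (sq_nonneg (∑ i, y (c i)))
        change _ * ((fun i => y (c i)) ⬝ᵥ fun i => y (c i))
          ≤ (fun i => y (c i)) ⬝ᵥ adjacency G *ᵥ fun i => y (c i)
        rw [dotProduct_adjacency_mulVec c p q, h1]
        linarith
    · have h := eigenvalues₀_le (adjacency_isHermitian G) j (m := 1) (by omega)
        (LinearMap.pi fun _ => ∑ i, LinearMap.proj i)
        (a := K * (p - q) + (1 - p) + η) fun x hx => ?_
      · linarith
      · have h0 : ∑ i, x i = 0 := by simpa using congrFun hx 0
        have h1 := mul_le_mul_of_nonneg_left (sum_cluster_sq_le hc x) hpq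
        have h3 := (abs_le.1 (hη x)).2
        rw [dotProduct_adjacency_mulVec c p q, h0]
        linarith
  · obtain ⟨j, hj, he⟩ := eig_eq (G := G) (by omega : 1 ≤ k) hkn
    rw [he, abs_le]
    constructor
    · have h := le_eigenvalues₀ (adjacency_isHermitian G) j (m := n) (by omega)
        (a := (1 - p) - η) LinearMap.id Function.injective_id fun x => ?_
      · linarith
      · have h1 : 0 ≤ ∑ a, (∑ i with c i = a, x i) ^ 2 := Finset.sum_nonneg fun a _ => sq_nonneg _
        have h2 := mul_nonneg hpq h1
        have h3 := mul_nonneg hq (sq_nonneg (∑ i, x i))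
        have h4 := (abs_le.1 (hη x)).1
        rw [LinearMap.id_apply, dotProduct_adjacency_mulVec c p q]
        linarith
    · have h := eigenvalues₀_le (adjacency_isHermitian G) j (m := r) (by omega)
        (LinearMap.pi fun a => ∑ i with c i = a, LinearMap.proj i)
        (a := (1 - p) + η) fun x hx => ?_
      · linarith
      · have h0 : ∀ a, ∑ i with c i = a, x i = 0 := fun a => by simpa using congrFun hx a
        have h1 : ∑ i, x i = 0 := by
          rw [← Finset.sum_fiberwise Finset.univ c]
          exact Finset.sum_eq_zero fun a _ => h0 a
        have h3 := (abs_le.1 (hη x)).2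
        rw [dotProduct_adjacency_mulVec c p q, h1]
        simp only [h0]
        rw [Finset.sum_eq_zero fun a _ => by norm_num]
        linarith

/-- The `argmax` of the gaps is `r` when the noise is small against the `r`-th gap
`K (p - q)`. -/
theorem isArgmaxGap_iff (hrn : r + 1 ≤ n) (hr : 2 ≤ r) {a b : ℝ} (hab : 4 * η < a - b)
    (h2 : ∀ k, 2 ≤ k → k ≤ r → |eig G k - a| ≤ η)
    (h3 : ∀ k, r + 1 ≤ k → k ≤ n → |eig G k - b| ≤ η) (s : ℕ) :
    IsArgmaxGap G s ↔ s = r := by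
  have hgap : a - b - 2 * η ≤ eig G r - eig G (r + 1) := by
    have h4 := abs_le.1 (h2 r hr le_rfl)
    have h5 := abs_le.1 (h3 (r + 1) le_rfl hrn)
    linarith [h4.1, h5.2]
  have hsmall : ∀ i ∈ Finset.Icc 2 (n - 1), i ≠ r → eig G i - eig G (i + 1) ≤ 2 * η := by
    intro i hi hne
    rw [Finset.mem_Icc] at hi
    rcases lt_or_gt_of_ne hne with h | h
    · have h4 := abs_le.1 (h2 i hi.1 h.le)
      have h5 := abs_le.1 (h2 (i + 1) (by omega) h)
      linarith [h4.2, h5.1]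
    · have h4 := abs_le.1 (h3 i h (by omega))
      have h5 := abs_le.1 (h3 (i + 1) (by omega) (by omega))
      linarith [h4.2, h5.1]
  have hrmem : r ∈ Finset.Icc 2 (n - 1) := Finset.mem_Icc.2 ⟨hr, by omega⟩
  constructor
  · rintro ⟨hs, hmax⟩
    by_contra hne
    linarith [hmax r hrmem, hsmall s hs hne]
  · rintro rfl
    refine ⟨hrmem, fun i hi => ?_⟩
    by_cases h : i = s
    · rw [h]
    · linarith [hsmall i hi h]

end EigenvalueBounds

/-! ### The estimators -/

section Sampling

theorem edgeNoise_eq_indicator {Ω : Type*} {n r : ℕ} (c : Fin n → Fin r) (p q : ℝ)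
    (G : Ω → SimpleGraph (Fin n)) (e : Edge n) (ω : Ω) : edgeNoise c p q (G ω) e
      = {ω | (G ω).Adj e.1.1 e.1.2}.indicator (fun _ => (1 : ℝ)) ω
        - if c e.1.1 = c e.1.2 then p else q := by
  by_cases h : (G ω).Adj e.1.1 e.1.2 <;> simp [edgeNoise, Set.indicator, h]

variable {Ω : Type*} [MeasurableSpace Ω] {μ : Measure Ω} {n r K : ℕ} {c : Fin n → Fin r} {p q : ℝ}
  {G : Ω → SimpleGraph (Fin n)}

theorem IsStandardSBM.eq_mul (h : IsStandardSBM μ c K p q G) : n = r * K := by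
  have h1 := Finset.card_eq_sum_card_fiberwise (f := c) (s := Finset.univ) (t := Finset.univ)
    fun _ _ => Finset.mem_coe.2 (Finset.mem_univ _)
  simpa [h.card_cluster] using h1

theorem IsStandardSBM.measurable_edgeNoise (h : IsStandardSBM μ c K p q G) (e : Edge n) :
    Measurable fun ω => edgeNoise c p q (G ω) e := by
  simp_rw [edgeNoise_eq_indicator]
  exact (measurable_const.indicator (h.measurableSet_adj _ _)).sub_const _

theorem IsStandardSBM.iIndepFun_edgeNoise (h : IsStandardSBM μ c K p q G) :
    iIndepFun (fun e ω => edgeNoise c p q (G ω) e) μ := by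
  simp_rw [edgeNoise_eq_indicator]
  exact (h.indep.iIndepFun_indicator (β := ℝ)).comp
    (fun e x => x - if c e.1.1 = c e.1.2 then p else q) fun e => measurable_id.sub_const _

theorem abs_edgeNoise_le (hq : 0 ≤ q) (hqp : q ≤ p) (hp : p ≤ 1) (G : SimpleGraph (Fin n))
    (e : Edge n) : |edgeNoise c p q G e| ≤ 1 := by
  rw [edgeNoise, abs_le]
  split_ifs <;> constructor <;> linarith

theorem IsStandardSBM.integral_indicator [IsProbabilityMeasure μ] (h : IsStandardSBM μ c K p q G)
    (hq : 0 ≤ q) (hqp : q ≤ p) (e : Edge n) :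
    ∫ ω, {ω | (G ω).Adj e.1.1 e.1.2}.indicator (fun _ => (1 : ℝ)) ω ∂μ
      = if c e.1.1 = c e.1.2 then p else q := by
  rw [integral_indicator_const _ (h.measurableSet_adj _ _), measureReal_def, h.prob_adj _ _ e.2,
    ENNReal.toReal_ofReal, smul_eq_mul, mul_one]
  split_ifs <;> linarith

theorem IsStandardSBM.integrable_indicator [IsProbabilityMeasure μ]
    (h : IsStandardSBM μ c K p q G) (e : Edge n) :
    Integrable ({ω | (G ω).Adj e.1.1 e.1.2}.indicator fun _ => (1 : ℝ)) μ :=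
  (integrable_const _).indicator (h.measurableSet_adj _ _)

theorem IsStandardSBM.integral_edgeNoise [IsProbabilityMeasure μ] (h : IsStandardSBM μ c K p q G)
    (hq : 0 ≤ q) (hqp : q ≤ p) (e : Edge n) : ∫ ω, edgeNoise c p q (G ω) e ∂μ = 0 := by
  simp_rw [edgeNoise_eq_indicator]
  rw [integral_sub (h.integrable_indicator e) (integrable_const _),
    h.integral_indicator hq hqp, integral_const, probReal_univ, one_smul, sub_self]

theorem IsStandardSBM.integral_edgeNoise_sq_le [IsProbabilityMeasure μ]
    (h : IsStandardSBM μ c K p q G) (hq : 0 ≤ q) (hqp : q ≤ p) (hp : p ≤ 1) (e : Edge n) :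
    ∫ ω, edgeNoise c p q (G ω) e ^ 2 ∂μ ≤ p * (1 - q) := by
  set θ : ℝ := if c e.1.1 = c e.1.2 then p else q with hθ
  have h1 : ∀ ω, edgeNoise c p q (G ω) e ^ 2
      = (1 - 2 * θ) * {ω | (G ω).Adj e.1.1 e.1.2}.indicator (fun _ => (1 : ℝ)) ω + θ ^ 2 := by
    intro ω
    rw [edgeNoise_eq_indicator, ← hθ]
    by_cases h : (G ω).Adj e.1.1 e.1.2 <;> simp only [Set.indicator, Set.mem_ofPred_eq, h,
      if_true, if_false] <;> ring
  simp_rw [h1]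
  rw [integral_add ((h.integrable_indicator e).const_mul _) (integrable_const _),
    integral_const_mul, h.integral_indicator hq hqp, integral_const, probReal_univ, one_smul, ← hθ]
  have h2 : q ≤ θ ∧ θ ≤ p := by
    rw [hθ]
    split_ifs <;> constructor <;> linarith
  nlinarith [h2.1, h2.2]

end Sampling

section Estimation

variable {n r K : ℕ} {c : Fin n → Fin r} {p q η : ℝ} {G : SimpleGraph (Fin n)}

/-- The estimators are linear in the two largest eigenvalues and exact without noise. -/
theorem output_of_noise_le (hc : ∀ a : Fin r, (Finset.univ.filter fun i => c i = a).card = K)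
    (hn : n = r * K) (hr : 2 ≤ r) (hK : 2 ≤ K) (hq : 0 ≤ q) (hqp : q ≤ p)
    (hη : ∀ x : Fin n → ℝ, |x ⬝ᵥ (edgeMatrix (edgeNoise c p q G)).mulVec x| ≤ η * (x ⬝ᵥ x))
    (hgap : 8 * η < K * (p - q)) :
    (∃ K' p' q' t : ℝ, IsOutput G K' p' q' t) ∧
      ∀ K' p' q' t : ℝ, IsOutput G K' p' q' t →
        K' = K ∧ max |p' - p| |q' - q| ≤ 2 * η / K ∧
        1 / 4 * p + 3 / 4 * q ≤ t ∧ t ≤ 3 / 4 * p + 1 / 4 * q := by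
  obtain ⟨h1, h2, h3⟩ := abs_eig_sub_le hc hn hr (by omega) hq hqp hη
  have hη0 : 0 ≤ η := (abs_nonneg _).trans h1
  have hKn : 2 * K ≤ n := by
    rw [hn]
    exact Nat.mul_le_mul_right K hr
  have hrn : r + 1 ≤ n := by nlinarith
  have harg := isArgmaxGap_iff (G := G) hrn hr (by linarith) h2 h3
  refine ⟨⟨_, _, _, _, r, (harg r).2 rfl, rfl, rfl, rfl, rfl⟩, ?_⟩
  rintro K' p' q' t ⟨s, hs, hK', hp', hq', ht⟩
  rw [harg s] at hs
  subst hs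
  have hr' : (0 : ℝ) < s := by exact_mod_cast (by omega : 0 < s)
  have hK2 : (2 : ℝ) ≤ K := by exact_mod_cast hK
  have hKn' : 2 * (K : ℝ) ≤ n := by exact_mod_cast hKn
  have hKK : K' = K := by
    rw [hK', hn]
    push_cast
    field_simp
  rw [hKK] at hp'
  have h1' := abs_le.1 h1
  have h2' := abs_le.1 (h2 2 le_rfl hr)
  have hn0 : (0 : ℝ) < n := by linarith
  have hK1 : (0 : ℝ) < K - 1 := by linarith
  have hqerr : |q' - q| ≤ 2 * η / K := by
    have e : q' - q = ((eig G 1 - (K * (p - q) + n * q + (1 - p)))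
        - (eig G 2 - (K * (p - q) + (1 - p)))) / n := by
      rw [hq']
      field_simp
      ring
    rw [e, abs_div, abs_of_pos hn0]
    refine div_le_div₀ (by linarith) ?_ (by linarith) (by linarith)
    rw [abs_le]
    constructor <;> linarith [h1'.1, h1'.2, h2'.1, h2'.2]
  have hperr : |p' - p| ≤ 2 * η / K := by
    have e : p' - p = (K * (eig G 1 - (K * (p - q) + n * q + (1 - p)))
        + (n - K) * (eig G 2 - (K * (p - q) + (1 - p)))) / (n * (K - 1)) := by
      rw [hp']
      field_simp
      ring
    have hden : 0 < (n : ℝ) * (K - 1) := by positivity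
    rw [e, abs_div, abs_of_pos hden, div_le_div_iff₀ (by positivity) (by linarith)]
    have h4 : |K * (eig G 1 - (K * (p - q) + n * q + (1 - p)))
        + (n - K) * (eig G 2 - (K * (p - q) + (1 - p)))| ≤ n * η := by
      rw [abs_le]
      constructor <;> nlinarith [h1'.1, h1'.2, h2'.1, h2'.2]
    calc _ ≤ n * η * K := by gcongr
      _ ≤ n * η * (2 * (K - 1)) := by
          gcongr
          linarith
      _ = 2 * η * (n * (K - 1)) := by ring
  have hfine : 2 * η / K ≤ 1 / 4 * (p - q) := by
    rw [div_le_iff₀ (by linarith)]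
    linarith
  have h5 := abs_le.1 (hperr.trans hfine)
  have h6 := abs_le.1 (hqerr.trans hfine)
  refine ⟨hKK, max_le hperr hqerr, ?_, ?_⟩ <;> rw [ht] <;> linarith [h5.1, h5.2, h6.1, h6.2]

/-- The assumption on the signal-to-noise ratio makes clusters large, the expected degrees at least
logarithmic, and the signal larger than the noise. -/
theorem signal_to_noise_consequences {n K : ℕ} {p q C : ℝ} (hC0 : 0 < C) (hK : 1 ≤ K) (hKn : K ≤ n)
    (hq : 0 ≤ q) (hqp : q < p) (hp : p ≤ 1)
    (hcond : 9 * (C + 1) * max (√(n : ℝ) / K) (Real.log n ^ 2 / √(K : ℝ))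
      ≤ (p - q) / √(p * (1 - q))) :
    p * (1 - q) ≤ 1 ∧ 2 ≤ K ∧ 1 ≤ √(n : ℝ) * √(p * (1 - q)) ∧
      Real.log n ≤ √n * √(p * (1 - q)) ∧
      9 * (C + 1) * (√n * √(p * (1 - q))) ≤ K * (p - q) := by
  have hK0 : (0 : ℝ) < K := by exact_mod_cast hK
  have hKn' : (K : ℝ) ≤ n := by exact_mod_cast hKn
  have hn0 : (0 : ℝ) < n := by linarith
  have hσ2 : 0 < p * (1 - q) := mul_pos (by linarith) (by linarith)
  have hσ21 : p * (1 - q) ≤ 1 := by nlinarith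
  set σ := √(p * (1 - q))
  have hσ : 0 < σ := Real.sqrt_pos.2 hσ2
  have hσsq : σ ^ 2 = p * (1 - q) := Real.sq_sqrt hσ2.le
  have hσ1 : σ ≤ 1 := Real.sqrt_le_one.2 hσ21
  have hs : √(n : ℝ) ^ 2 = n := Real.sq_sqrt hn0.le
  have hs0 : 0 < √(n : ℝ) := Real.sqrt_pos.2 hn0
  have hsK0 : 0 < √(K : ℝ) := Real.sqrt_pos.2 hK0
  have hsKn : √(K : ℝ) ≤ √n := Real.sqrt_le_sqrt hKn'
  -- As `p - q ≤ p (1 - q) = σ²`, the signal-to-noise ratio is itself at most `σ`.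
  have hratio : (p - q) / σ ≤ σ := by
    rw [div_le_iff₀ hσ, ← sq, hσsq]
    nlinarith
  rw [mul_max_of_nonneg _ _ (by positivity), max_le_iff] at hcond
  obtain ⟨hcond1, hcond2⟩ := hcond
  have hgap : 9 * (C + 1) * (√n * σ) ≤ K * (p - q) := by
    rw [le_div_iff₀ hσ, mul_div_assoc', div_mul_eq_mul_div, div_le_iff₀ hK0] at hcond1
    linarith
  have hKs : 9 * √(n : ℝ) ≤ K := by
    have h := hcond1.trans (hratio.trans hσ1)
    rw [mul_div_assoc', div_le_one hK0] at h
    nlinarith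
  have hsn : 9 ≤ √(n : ℝ) := by nlinarith
  have hK2 : 2 ≤ K := by
    have h : (2 : ℝ) ≤ K := by linarith
    exact_mod_cast h
  have hn3 : (3 : ℝ) ≤ n := by nlinarith
  have hσn : 1 ≤ √(n : ℝ) * σ := by
    have h := hcond1.trans hratio
    rw [mul_div_assoc', div_le_iff₀ hK0] at h
    have h1 : √(n : ℝ) * 1 ≤ √n * (√n * σ) := by
      calc √(n : ℝ) * 1 ≤ 9 * (C + 1) * √n := by nlinarith
        _ ≤ σ * K := h
        _ ≤ σ * n := by gcongr
        _ = √n * (√n * σ) := by rw [← mul_assoc, ← sq, hs, mul_comm]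
    exact le_of_mul_le_mul_left h1 hs0
  have hlog1 : 1 ≤ Real.log n := by
    rw [Real.le_log_iff_exp_le hn0]
    linarith [Real.exp_one_lt_three]
  have hlog : Real.log n ≤ √n * σ := by
    have h := hcond2.trans hratio
    rw [mul_div_assoc', div_le_iff₀ hsK0] at h
    calc Real.log n ≤ 9 * (C + 1) * Real.log n ^ 2 := by nlinarith
      _ ≤ σ * √K := h
      _ ≤ σ * √n := by gcongr
      _ = √n * σ := mul_comm _ _
  exact ⟨hσ21, hK2, hσn, hlog, hgap⟩

end Estimation

end BlockModel

open BlockModel in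
theorem theorem3 :
    ∃ c₀ c₁ c₄ : ℝ, 0 < c₀ ∧ 0 < c₁ ∧ 0 < c₄ ∧
      ∀ (n r K : ℕ) (p q : ℝ), 2 ≤ r → 1 ≤ K → 0 ≤ q → q < p → p ≤ 1 →
      c₁ * max (√(n : ℝ) / K) (Real.log n ^ 2 / √(K : ℝ)) ≤ (p - q) / √(p * (1 - q)) →
      ∀ {Ω : Type*} [MeasurableSpace Ω] (μ : Measure Ω) [IsProbabilityMeasure μ]
        (c : Fin n → Fin r) (G : Ω → SimpleGraph (Fin n)),
      BlockModel.IsStandardSBM μ c K p q G →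
      1 - c₀ / (n : ℝ) ^ 8 ≤
        μ.real {ω |
          (∃ K' p' q' t : ℝ, BlockModel.IsOutput (G ω) K' p' q' t) ∧
          ∀ K' p' q' t : ℝ, BlockModel.IsOutput (G ω) K' p' q' t →
            K' = K ∧
            max |p' - p| |q' - q| ≤ c₄ * (√(p * (1 - q) * n) / K) ∧
            1 / 4 * p + 3 / 4 * q ≤ t ∧ t ≤ 3 / 4 * p + 1 / 4 * q} := by
  obtain ⟨C, hC0, hC⟩ := exists_noise_bound
  -- With this second constant `8 η < K (p - q)` for the noise level `η = C √(n p (1 - q))`.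
  refine ⟨1, 9 * (C + 1), 2 * C, one_pos, by positivity, by positivity, ?_⟩
  intro n r K p q hr hK hq hqp hp hcond Ω _ μ _ c G hG
  have hn : n = r * K := hG.eq_mul
  have hKn : K ≤ n := by
    rw [hn]
    exact Nat.le_mul_of_pos_left _ (by omega)
  obtain ⟨hσ21, hK2, hσn, hlog, hgap⟩ :=
    signal_to_noise_consequences hC0 hK hKn hq hqp hp hcond
  have hnσ : (n : ℝ) * (p * (1 - q)) = (√n * √(p * (1 - q))) ^ 2 := by
    rw [mul_pow, Real.sq_sqrt (Nat.cast_nonneg _),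
      Real.sq_sqrt (mul_nonneg (by linarith) (by linarith))]
  have hη : √((n : ℝ) * (p * (1 - q))) = √n * √(p * (1 - q)) := by
    rw [hnσ, Real.sqrt_sq (by positivity)]
  have hle : √n * √(p * (1 - q)) ≤ n * (p * (1 - q)) := by
    rw [hnσ]
    exact le_self_pow₀ hσn two_ne_zero
  obtain ⟨s, hs1, hs2⟩ := hC n (p * (1 - q)) (by omega) hσ21 (hσn.trans hle)
    (hlog.trans hle) μ (fun e ω => edgeNoise c p q (G ω) e) hG.iIndepFun_edgeNoise
    hG.measurable_edgeNoise (fun e ω => abs_edgeNoise_le hq hqp.le hp _ e)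
    (hG.integral_edgeNoise hq hqp.le) (hG.integral_edgeNoise_sq_le hq hqp.le hp)
  refine hs1.trans (measureReal_mono fun ω hω => ?_)
  have hout := output_of_noise_le hG.card_cluster hn hr hK2 hq hqp.le (hs2 ω hω) (by
    rw [hη]
    linarith [mul_pos hC0 (zero_lt_one.trans_le hσn)])
  have heq : 2 * C * (√(p * (1 - q) * n) / K) = 2 * (C * √(n * (p * (1 - q)))) / K := by
    rw [mul_comm (n : ℝ)]
    ring
  simpa only [Set.mem_ofPred_eq, heq] using hout
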